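/- A Banach space $X$ is called a Grothendieck space if every weak*-null sequence in the dual space $X^*$ converges to $0$ weakly (that is, with respect to $\sigma(X^*,X^{**})$). For C*-algebras $E$ and $F$ (not necessarily unital) let $E\odot F$ denote their algebraic tensor product over $\mathbb{C}$ with its natural *-algebra structure. A C*-norm on $E\odot F$ is a norm $\gamma$ that is submultiplicative and satisfies $\gamma(x^*x)=\gamma(x)^2$ for all $x\in E\odot F$; the completion of $E\odot F$ with respect to $\gamma$ is a C*-algebra, denoted $E\otimes_\gamma F$. Theorem. Let $A$ be a complex C*-algebra which, as a Banach space, is a Grothendieck space. Suppose that $E$ and $F$ are C*-algebras such that $A$ is *-isomorphic to $E\otimes_\gamma F$ for some C*-norm $\gamma$ on $E\odot F$. Then $E$ is finite-dimensional or $F$ is finite-dimensional (or both). -/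

import Mathlib

open Filter Topology
open scoped TensorProduct

/-- A normed space `X` is a *Grothendieck space* if every weak-* null sequence in its dual
is weakly null, i.e. null for the weak topology of the normed space `X*`. -/
def IsGrothendieckSpace (𝕜 X : Type*) [RCLike 𝕜] [NormedAddCommGroup X] [NormedSpace 𝕜 X] :
    Prop :=
  ∀ φ : ℕ → StrongDual 𝕜 X,
    Tendsto (fun n => StrongDual.toWeakDual (φ n)) atTop (𝓝 0) →
      Tendsto (fun n => toWeakSpace 𝕜 (StrongDual 𝕜 X) (φ n)) atTop (𝓝 0)

/-- A *C⋆-norm* on a complex `⋆`-algebra `B`: a norm (definite, subadditive, homogeneous) that is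
submultiplicative and satisfies the C⋆-identity. Completeness is not required. -/
structure CStarNorm (B : Type*) [NonUnitalRing B] [Module ℂ B] [Star B] extends RingNorm B where
  smul' : ∀ (c : ℂ) (x : B), toFun (c • x) = ‖c‖ * toFun x
  star_mul_self' : ∀ x : B, toFun (star x * x) = toFun x ^ 2

namespace CStarNorm

section

variable {B : Type*} [NonUnitalRing B] [StarRing B] [Module ℂ B]

/-- The `⋆`-algebra `B`, regarded as a normed `⋆`-algebra with the norm `γ`. -/
def Normed (_γ : CStarNorm B) : Type _ := B

variable (γ : CStarNorm B)

noncomputable instance : NonUnitalNormedRing γ.Normed where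
  __ := (inferInstance : NonUnitalRing B)
  __ := γ.toRingNorm.toAddGroupNorm.toNormedAddCommGroup
  norm_mul_le := γ.mul_le'

noncomputable instance : StarRing γ.Normed := inferInstanceAs (StarRing B)

noncomputable instance : NormedSpace ℂ γ.Normed where
  __ := (inferInstance : Module ℂ B)
  norm_smul_le c x := (γ.smul' c x).le

instance [StarModule ℂ B] : StarModule ℂ γ.Normed := inferInstanceAs (StarModule ℂ B)

instance [IsScalarTower ℂ B B] : IsScalarTower ℂ γ.Normed γ.Normed := inferInstanceAs (IsScalarTower ℂ B B)

instance [SMulCommClass ℂ B B] : SMulCommClass ℂ γ.Normed γ.Normed := inferInstanceAs (SMulCommClass ℂ B B)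

instance : CStarRing γ.Normed where
  norm_mul_self_le x := ((pow_two _).symm.trans (γ.star_mul_self' x).symm).le

/-- The completion of the `⋆`-algebra `B` with respect to the C⋆-norm `γ`. It carries the
continuous extensions of the norm, the linear structure, the product and the involution of `B`,
and is a C⋆-algebra. -/
def Completion : Type _ := UniformSpace.Completion γ.Normed

namespace Completion

noncomputable instance : NormedAddCommGroup γ.Completion :=
  inferInstanceAs (NormedAddCommGroup (UniformSpace.Completion γ.Normed))

noncomputable instance : NormedSpace ℂ γ.Completion :=
  inferInstanceAs (NormedSpace ℂ (UniformSpace.Completion γ.Normed))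

instance : CompleteSpace γ.Completion :=
  inferInstanceAs (CompleteSpace (UniformSpace.Completion γ.Normed))

/-- The canonical linear isometry of `B`, normed by `γ`, into its completion. -/
noncomputable def of : γ.Normed →ₗᵢ[ℂ] γ.Completion :=
  UniformSpace.Completion.toComplₗᵢ

variable {γ}

theorem isDenseInducing_of : IsDenseInducing (of γ) :=
  UniformSpace.Completion.isDenseInducing_coe

theorem induction₁ {p : γ.Completion → Prop} (hp : IsClosed {x | p x})
    (h : ∀ a, p (of γ a)) (x : γ.Completion) : p x :=
  UniformSpace.Completion.induction_on x hp h

theorem induction₂ {p : γ.Completion → γ.Completion → Prop}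
    (hp : IsClosed {x : γ.Completion × γ.Completion | p x.1 x.2})
    (h : ∀ a b, p (of γ a) (of γ b)) (x y : γ.Completion) : p x y :=
  UniformSpace.Completion.induction_on₂ x y hp h

theorem induction₃ {p : γ.Completion → γ.Completion → γ.Completion → Prop}
    (hp : IsClosed {x : γ.Completion × γ.Completion × γ.Completion | p x.1 x.2.1 x.2.2})
    (h : ∀ a b c, p (of γ a) (of γ b) (of γ c)) (x y z : γ.Completion) : p x y z :=
  UniformSpace.Completion.induction_on₃ x y z hp h

noncomputable instance : Mul γ.Completion where
  mul x y := ((isDenseInducing_of (γ := γ)).prodMap isDenseInducing_of).extend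
    (fun p : γ.Normed × γ.Normed => of γ (p.1 * p.2)) (x, y)

theorem of_mul (a b : γ.Normed) : of γ (a * b) = of γ a * of γ b :=
  (((isDenseInducing_of (γ := γ)).prodMap isDenseInducing_of).extend_eq
    ((of γ).continuous.comp continuous_mul) (a, b)).symm

instance : ContinuousMul γ.Completion where
  continuous_mul := by
    let f : γ.Normed →+ γ.Completion := (of γ).toLinearMap.toAddMonoidHom
    let m := (AddMonoidHom.mul : γ.Normed →+ γ.Normed →+ γ.Normed).compr₂ f
    have hm : Continuous fun p : γ.Normed × γ.Normed => m p.1 p.2 :=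
      (of γ).continuous.comp continuous_mul
    have di : IsDenseInducing (f : γ.Normed → γ.Completion) := isDenseInducing_of
    exact (di.extend_Z_bilin di hm :)

theorem zero_mul_aux : ∀ x : γ.Completion, 0 * x = 0 :=
  induction₁ (isClosed_eq (by fun_prop) (by fun_prop)) fun a => by
    rw [← map_zero (of γ), ← of_mul, zero_mul]

theorem mul_zero_aux : ∀ x : γ.Completion, x * 0 = 0 :=
  induction₁ (isClosed_eq (by fun_prop) (by fun_prop)) fun a => by
    rw [← map_zero (of γ), ← of_mul, mul_zero]

theorem mul_assoc_aux : ∀ x y z : γ.Completion, x * y * z = x * (y * z) :=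
  induction₃ (isClosed_eq (by fun_prop) (by fun_prop)) fun a b c => by
    simp only [← of_mul, mul_assoc]

theorem mul_add_aux : ∀ x y z : γ.Completion, x * (y + z) = x * y + x * z :=
  induction₃ (isClosed_eq (by fun_prop) (by fun_prop)) fun a b c => by
    simp only [← of_mul, ← map_add, mul_add]

theorem add_mul_aux : ∀ x y z : γ.Completion, (x + y) * z = x * z + y * z :=
  induction₃ (isClosed_eq (by fun_prop) (by fun_prop)) fun a b c => by
    simp only [← of_mul, ← map_add, add_mul]

theorem norm_mul_le_aux : ∀ x y : γ.Completion, ‖x * y‖ ≤ ‖x‖ * ‖y‖ :=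
  induction₂ (isClosed_le (by fun_prop) (by fun_prop)) fun a b => by
    simpa only [← of_mul, LinearIsometry.norm_map] using norm_mul_le a b

theorem smul_mul_aux [IsScalarTower ℂ B B] (c : ℂ) :
    ∀ x y : γ.Completion, (c • x) * y = c • (x * y) :=
  induction₂ (isClosed_eq ((continuous_fst.const_smul c).mul continuous_snd)
    (continuous_mul.const_smul c)) fun a b => by
    simp only [← of_mul, ← LinearIsometry.map_smul, smul_mul_assoc]

theorem mul_smul_aux [SMulCommClass ℂ B B] (c : ℂ) :
    ∀ x y : γ.Completion, c • (x * y) = x * (c • y) :=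
  induction₂ (isClosed_eq (continuous_mul.const_smul c)
    (continuous_fst.mul (continuous_snd.const_smul c))) fun a b => by
    simp only [← of_mul, ← LinearIsometry.map_smul, mul_smul_comm]

noncomputable instance : Star γ.Completion where
  star := isDenseInducing_of.extend (fun a : γ.Normed => of γ (star a))

theorem of_star (a : γ.Normed) : of γ (star a) = star (of γ a) :=
  ((isDenseInducing_of (γ := γ)).extend_eq ((of γ).continuous.comp continuous_star) a).symm

instance : ContinuousStar γ.Completion where
  continuous_star := by
    let f : γ.Normed →+ γ.Completion :=
      (of γ).toLinearMap.toAddMonoidHom.comp (starAddEquiv : γ.Normed ≃+ γ.Normed).toAddMonoidHom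
    have hf : UniformContinuous f :=
      uniformContinuous_addMonoidHom_of_continuous ((of γ).continuous.comp continuous_star)
    exact uniformContinuous_uniformly_extend
      (UniformSpace.Completion.isUniformInducing_coe γ.Normed)
      UniformSpace.Completion.denseRange_coe hf |>.continuous

theorem star_star_aux : ∀ x : γ.Completion, star (star x) = x :=
  induction₁ (isClosed_eq (by fun_prop) (by fun_prop)) fun a => by
    rw [← of_star, ← of_star, star_star]

theorem star_mul_aux : ∀ x y : γ.Completion, star (x * y) = star y * star x :=
  induction₂ (isClosed_eq (by fun_prop) (by fun_prop)) fun a b => by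
    simp only [← of_mul, ← of_star, star_mul]

theorem star_add_aux : ∀ x y : γ.Completion, star (x + y) = star x + star y :=
  induction₂ (isClosed_eq (by fun_prop) (by fun_prop)) fun a b => by
    simp only [← map_add, ← of_star, star_add]

theorem star_smul_aux [StarModule ℂ B] (c : ℂ) :
    ∀ x : γ.Completion, star (c • x) = star c • star x :=
  induction₁ (isClosed_eq (continuous_id.const_smul c).star
    ((continuous_const_smul (star c)).comp continuous_star)) fun a => by
    simp only [← of_star, ← LinearIsometry.map_smul, star_smul]

theorem norm_mul_self_le_aux : ∀ x : γ.Completion, ‖x‖ * ‖x‖ ≤ ‖star x * x‖ :=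
  induction₁ (isClosed_le (by fun_prop) (by fun_prop)) fun a => by
    simpa only [← of_star, ← of_mul, LinearIsometry.norm_map] using CStarRing.norm_mul_self_le a

noncomputable instance [StarModule ℂ B] [IsScalarTower ℂ B B] [SMulCommClass ℂ B B] :
    NonUnitalCStarAlgebra γ.Completion where
  __ := (inferInstance : NormedAddCommGroup γ.Completion)
  __ := (inferInstance : NormedSpace ℂ γ.Completion)
  __ := (inferInstance : CompleteSpace γ.Completion)
  __ := (inferInstance : Mul γ.Completion)
  __ := (inferInstance : Star γ.Completion)
  zero_mul := zero_mul_aux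
  mul_zero := mul_zero_aux
  mul_assoc := mul_assoc_aux
  left_distrib := mul_add_aux
  right_distrib := add_mul_aux
  norm_mul_le := norm_mul_le_aux
  star_involutive := star_star_aux
  star_mul := star_mul_aux
  star_add := star_add_aux
  norm_mul_self_le := norm_mul_self_le_aux
  smul_assoc := smul_mul_aux
  smul_comm c x y := mul_smul_aux c x y
  star_smul := star_smul_aux

end Completion

end

end CStarNorm

/-- The C⋆-tensor product `E ⊗_γ F`: the completion of the algebraic tensor product `E ⊗[ℂ] F`,
a `⋆`-algebra with `(a ⊗ b) * (c ⊗ d) = (a * c) ⊗ (b * d)` and `star (a ⊗ b) = star a ⊗ star b`,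
with respect to the C⋆-norm `γ`. -/
abbrev CStarTensorProduct (E F : Type*) [NonUnitalCStarAlgebra E] [NonUnitalCStarAlgebra F]
    (γ : CStarNorm (E ⊗[ℂ] F)) : Type _ :=
  γ.Completion

/-! Suppose both factors are infinite-dimensional. Each then contains pairwise orthogonal positive
norm-one elements, `f k` in `E` and `g i` in `F` (`exists_orthogonal_sequence`). Choose positive
functionals `φ k` and `ψ i` peaking at them, with `φ k` pure. Purity makes slicing by `φ k`
contractive for any C⋆-norm (`TensorRep.norm_slice_le`), so every `φ k ⊗ ψ i` extends to a
functional of norm at most one.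

For each `n`, give every sign pattern `s` of length `n + 1` its own index `k`, and let `Θ n` be the
average over `s` and `i ≤ n` of `s i • φ k ⊗ ψ i`. On an elementary tensor, orthogonality of the
signs and Cauchy-Schwarz make `Θ n` of order `(n + 1)^(-1/2)`. As `‖Θ n‖ ≤ 1`, the sequence is
weak-* null.

The elements `s i • f k ⊗ g i` are self-adjoint, pairwise orthogonal and of norm one
(`TensorRep.norm_eq`). Hence their sums `z N` over the blocks `n < N` stay in the unit ball, while
`Θ m (z N) = 1` for `m < N`. A weak-* cluster point of `z N` in the bidual takes the value one on
every `Θ m`, so `Θ` is not weakly null (`IsGrothendieckSpace.not_biorthogonal`). -/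

section

open scoped ComplexOrder

/-! ### Positive functionals and peak states. -/

section PositiveFunctionals

variable {A : Type*} [NonUnitalCStarAlgebra A] [PartialOrder A] [StarOrderedRing A]

/-- The Cauchy-Schwarz inequality for positive functionals. -/
theorem PositiveLinearMap.norm_apply_star_mul_sq_le (f : A →ₚ[ℂ] ℂ) (x y : A) :
    ‖f (star x * y)‖ ^ 2 ≤ (f (star x * x)).re * (f (star y * y)).re := by
  have h := norm_inner_le_norm (𝕜 := ℂ) (f.toPreGNS x) (f.toPreGNS y)
  have hx := f.preGNS_norm_sq (f.toPreGNS x)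
  have hy := f.preGNS_norm_sq (f.toPreGNS y)
  simp only [preGNS_inner_def, ofPreGNS_toPreGNS] at h hx hy
  rw [← hx, ← hy]
  norm_cast
  rw [← mul_pow]
  exact pow_le_pow_left₀ (norm_nonneg _) h 2

theorem LinearMap.norm_apply_star_mul_sq_le {f : A →ₗ[ℂ] ℂ} (hf : ∀ x, 0 ≤ x → 0 ≤ f x)
    (x y : A) : ‖f (star x * y)‖ ^ 2 ≤ (f (star x * x)).re * (f (star y * y)).re :=
  (PositiveLinearMap.mk₀ f hf).norm_apply_star_mul_sq_le x y

/-- A norm-one functional on a unital C⋆-algebra that takes the value one at the unit is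
positive. -/
theorem nonneg_apply_of_map_one {B : Type*} [CStarAlgebra B] [PartialOrder B] [StarOrderedRing B]
    {ω : StrongDual ℂ B} (hω : ‖ω‖ ≤ 1) (h1 : ω 1 = 1) {x : B} (hx : 0 ≤ x) : 0 ≤ ω x := by
  rcases subsingleton_or_nontrivial B with hB | hB
  · simp [Subsingleton.elim x 0]
  have hle (y : B) : ‖ω y‖ ≤ ‖y‖ := (ω.le_opNorm y).trans (by nlinarith [norm_nonneg y])
  have hxs : IsSelfAdjoint x := .of_nonneg hx
  have him : (ω x).im = 0 := by
    by_contra hne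
    -- Evaluating at `x + it` gives `t ^ 2` on both sides; what remains is a bound on a linear
    -- function of `t`, impossible when its slope is nonzero.
    have key (t : ℝ) : ((ω x).im + t) ^ 2 ≤ ‖x‖ ^ 2 + t ^ 2 := by
      have e : ω (x + (t * Complex.I) • (1 : B)) = ω x + t * Complex.I := by simp [h1]
      have h2 : ‖x + (t * Complex.I) • (1 : B)‖ ^ 2 ≤ ‖x‖ ^ 2 + t ^ 2 := by
        rw [sq, ← CStarRing.norm_star_mul_self]
        have : star (x + (t * Complex.I) • (1 : B)) * (x + (t * Complex.I) • (1 : B))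
            = x * x + ((t ^ 2 : ℝ) : ℂ) • (1 : B) := by
          simp only [star_add, hxs.star_eq, star_smul, star_one, add_mul, mul_add, smul_mul_assoc,
            one_mul, mul_smul_comm, mul_one]
          have h3 : star (t * Complex.I) = - (t * Complex.I) := by simp
          have h4 : (t * Complex.I) * -(t * Complex.I) = ((t ^ 2 : ℝ) : ℂ) := by
            push_cast
            linear_combination (-(t : ℂ) ^ 2) * Complex.I_sq
          rw [h3, smul_add, smul_smul, h4, neg_smul]
          abel
        rw [this]
        refine (norm_add_le _ _).trans (add_le_add ((norm_mul_le _ _).trans (sq _).ge) ?_)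
        rw [norm_smul, norm_one, mul_one, Complex.norm_real, Real.norm_of_nonneg (sq_nonneg t)]
      have h4 := (pow_le_pow_left₀ (norm_nonneg _) (hle _) 2).trans h2
      rw [e, Complex.sq_norm, Complex.normSq_apply] at h4
      simp at h4
      nlinarith [sq_nonneg (ω x).re]
    have := key ((‖x‖ ^ 2 + 1) / (2 * (ω x).im))
    have e : 2 * (ω x).im * ((‖x‖ ^ 2 + 1) / (2 * (ω x).im)) = ‖x‖ ^ 2 + 1 := by
      field_simp
    nlinarith [sq_nonneg (ω x).im]
  have hre : 0 ≤ (ω x).re := by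
    have e : ω ((‖x‖ : ℂ) • (1 : B) - x) = ‖x‖ - ω x := by simp [h1]
    have h2 : ‖(‖x‖ : ℂ) • (1 : B) - x‖ ≤ ‖x‖ := by
      have h3 : (‖x‖ : ℂ) • (1 : B) = algebraMap ℝ B ‖x‖ := by
        rw [Algebra.algebraMap_eq_smul_one, Complex.coe_smul]
      rw [h3, CStarAlgebra.norm_le_iff_le_algebraMap _ (norm_nonneg x)
        (sub_nonneg.2 hxs.le_algebraMap_norm_self)]
      simpa using hx
    have h4 := (Complex.abs_re_le_norm _).trans ((hle _).trans h2)
    rw [e] at h4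
    have := (abs_le.1 h4).2
    simp at this
    linarith
  exact Complex.nonneg_iff.2 ⟨hre, him.symm⟩

/-- The positive functionals that take the value one at `f` and are concentrated
where `f` is equal to one. -/
structure IsPeakState (f : A) (φ : A →ₗ[ℂ] ℂ) : Prop where
  nonneg : ∀ x, 0 ≤ x → 0 ≤ φ x
  map_left : ∀ x, φ (f * x) = φ x
  map_right : ∀ x, φ (x * f) = φ x
  map_self : φ f = 1

/-- The bound forces `l` to vanish on the kernel of `j`, so `l` descends to the range, where
Hahn-Banach applies. -/
theorem exists_dual_of_forall_norm_le {V W : Type*} [AddCommGroup V] [Module ℂ V]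
    [NormedAddCommGroup W] [NormedSpace ℂ W] (j : V →ₗ[ℂ] W) (l : V →ₗ[ℂ] ℂ) {C : ℝ}
    (hC : 0 ≤ C) (h : ∀ v, ‖l v‖ ≤ C * ‖j v‖) :
    ∃ Ψ : StrongDual ℂ W, ‖Ψ‖ ≤ C ∧ ∀ v, Ψ (j v) = l v := by
  have hker : LinearMap.ker j ≤ LinearMap.ker l := fun v hv => by
    have := h v
    rw [LinearMap.mem_ker.1 hv, norm_zero, mul_zero] at this
    simpa using this
  let l' : LinearMap.range j →ₗ[ℂ] ℂ :=
    ((LinearMap.ker j).liftQ l hker).comp j.quotKerEquivRange.symm.toLinearMap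
  have hl' (v : V) : l' ⟨j v, v, rfl⟩ = l v := by
    have : j.quotKerEquivRange.symm ⟨j v, v, rfl⟩ = (LinearMap.ker j).mkQ v := by
      rw [LinearEquiv.symm_apply_eq]; rfl
    simp [l', this]
  have hb : ∀ w : LinearMap.range j, ‖l' w‖ ≤ C * ‖w‖ := by
    rintro ⟨_, v, rfl⟩
    rw [hl']
    exact h v
  obtain ⟨Ψ, h1, h2⟩ := exists_extension_norm_eq (LinearMap.range j) (l'.mkContinuous C hb)
  refine ⟨Ψ, h2.trans_le (LinearMap.mkContinuous_norm_le _ hC _), fun v => ?_⟩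
  rw [← hl' v]
  exact h1 ⟨j v, v, rfl⟩

/-- In the unitization `2h - 1` is a contraction, so a Hahn-Banach extension `Ω` satisfies `|2 - Ω
1| ≤ 1` and `|Ω 1| ≤ 1`. Thus `Ω 1 = 1` and `Ω` is positive. Since `Ω ((1 - h)²) ≤ Ω (1 - h) = 0`,
Cauchy-Schwarz kills all multiples of `1 - h`. -/
theorem isPeakState_of_norm_le_one {ω : StrongDual ℂ A} (hω : ‖ω‖ ≤ 1) {h : A} (h0 : 0 ≤ h)
    (h1 : ‖h‖ ≤ 1) (hωh : ω h = 1) : IsPeakState h ω.toLinearMap := by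
  obtain ⟨Ω, hΩ, hext⟩ := exists_dual_of_forall_norm_le
    (Unitization.inrHom ℂ ℂ A) ω.toLinearMap zero_le_one (fun v => by
      have : ‖Unitization.inrHom ℂ ℂ A v‖ = ‖v‖ := Unitization.norm_inr v
      rw [this]
      exact (ω.le_opNorm v).trans (by gcongr))
  have hext (v : A) : Ω (v : Unitization ℂ A) = ω v := hext v
  have hle (y : Unitization ℂ A) : ‖Ω y‖ ≤ ‖y‖ :=
    (Ω.le_opNorm y).trans (by nlinarith [norm_nonneg y])
  have h0' : 0 ≤ (h : Unitization ℂ A) := Unitization.inr_nonneg_iff.2 h0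
  have h1' : (h : Unitization ℂ A) ≤ 1 := by
    rw [← CStarAlgebra.norm_le_one_iff_of_nonneg _ h0', Unitization.norm_inr]
    exact h1
  have hΩ1 : Ω 1 = 1 := by
    have e1 : ‖Ω 1‖ ≤ 1 := (hle 1).trans (by simp)
    have e2 : ‖Ω ((2 : ℂ) • (h : Unitization ℂ A) - 1)‖ ≤ 1 := by
      refine (hle _).trans ?_
      have e3 : (h : Unitization ℂ A) * h ≤ h := by
        simpa [sq] using CStarAlgebra.pow_antitone h0' h1' one_le_two
      have e4 : star ((2 : ℂ) • (h : Unitization ℂ A) - 1) * ((2 : ℂ) • (h : Unitization ℂ A) - 1)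
          = 1 - (4 : ℝ) • ((h : Unitization ℂ A) - h * h) := by
        have e5 : star (2 : ℂ) = 2 := by simp
        rw [star_sub, star_smul, (IsSelfAdjoint.of_nonneg h0').star_eq, star_one, e5, two_smul,
          smul_sub]
        have e6 (x : Unitization ℂ A) : (4 : ℝ) • x = x + x + x + x := by
          rw [show (4 : ℝ) = 1 + 1 + 1 + 1 by norm_num]; simp only [add_smul, one_smul]
        rw [e6, e6]
        noncomm_ring
      rw [← sq_le_one_iff₀ (norm_nonneg _), sq, ← CStarRing.norm_star_mul_self,
        CStarAlgebra.norm_le_one_iff_of_nonneg _ (star_mul_self_nonneg _), e4]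
      exact sub_le_self _ (smul_nonneg (by norm_num) (sub_nonneg.2 e3))
    rw [map_sub, map_smul, hext, hωh] at e2
    have e3 := (Complex.abs_re_le_norm _).trans e2
    have e4 := (Complex.abs_re_le_norm _).trans e1
    simp at e3
    have e5 : (Ω 1).re = 1 := le_antisymm (abs_le.1 e4).2 (by linarith [(abs_le.1 e3).2])
    apply Complex.ext
    · simpa using e5
    · have := pow_le_pow_left₀ (norm_nonneg _) e1 2
      rw [Complex.sq_norm, Complex.normSq_apply, e5] at this
      have : (Ω 1).im ^ 2 ≤ 0 := by nlinarith
      simpa using le_antisymm this (sq_nonneg _)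
  have hpos (x : Unitization ℂ A) (hx : 0 ≤ x) : 0 ≤ Ω x := nonneg_apply_of_map_one hΩ hΩ1 hx
  have hs : star (1 - (h : Unitization ℂ A)) = 1 - h :=
    (IsSelfAdjoint.of_nonneg (sub_nonneg.2 h1')).star_eq
  have hsq : Ω (star (1 - (h : Unitization ℂ A)) * (1 - h)) = 0 := by
    have e : star (1 - (h : Unitization ℂ A)) * (1 - h) ≤ 1 - h := by
      have := CStarAlgebra.pow_antitone (sub_nonneg.2 h1') (sub_le_self 1 h0') one_le_two
      rw [hs]
      simpa [sq] using this
    have e1 := hpos _ (sub_nonneg.2 e)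
    have e2 := hpos _ (star_mul_self_nonneg (1 - (h : Unitization ℂ A)))
    rw [map_sub, map_sub, hΩ1, hext, hωh, sub_self, zero_sub] at e1
    exact le_antisymm (by simpa using e1) e2
  have hl (x : Unitization ℂ A) : Ω ((1 - h) * x) = 0 := by
    have := LinearMap.norm_apply_star_mul_sq_le (f := Ω.toLinearMap) hpos (1 - h) x
    simp only [ContinuousLinearMap.coe_coe, hsq] at this
    rw [hs] at this
    simpa using this
  have hr (x : Unitization ℂ A) : Ω (x * (1 - h)) = 0 := by
    have := LinearMap.norm_apply_star_mul_sq_le (f := Ω.toLinearMap) hpos (star x) (1 - h)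
    simp only [ContinuousLinearMap.coe_coe, hsq] at this
    simpa using this
  refine ⟨fun x hx => ?_, fun x => ?_, fun x => ?_, hωh⟩
  · simpa [← hext] using hpos x (Unitization.inr_nonneg_iff.2 hx)
  · have := hl x
    rw [sub_mul, one_mul, map_sub, ← Unitization.inr_mul, hext, hext, sub_eq_zero] at this
    exact this.symm
  · have := hr x
    rw [mul_sub, mul_one, map_sub, ← Unitization.inr_mul, hext, hext, sub_eq_zero] at this
    exact this.symm

theorem exists_dual_isPeakState {f : A} (h0 : 0 ≤ f) (h1 : ‖f‖ = 1) :
    ∃ ω : StrongDual ℂ A, ‖ω‖ ≤ 1 ∧ IsPeakState f ω.toLinearMap := by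
  obtain ⟨ω, h2, h3⟩ := exists_dual_vector ℂ f (by simp [h1])
  exact ⟨ω, h2.le, isPeakState_of_norm_le_one h2.le h0 h1.le (by simp [h3, h1])⟩

theorem LinearMap.eq_of_forall_nonneg {V : Type*} [AddCommGroup V] [Module ℂ V]
    {f g : A →ₗ[ℂ] V} (h : ∀ x, 0 ≤ x → f x = g x) : f = g :=
  LinearMap.ext_on (CStarAlgebra.span_nonneg (A := A)) h

/-- Here `f` plays the role of a unit: Cauchy-Schwarz with `f` bounds `|φ x|²` by `φ (x⋆x) = φ (f
x⋆x f)`, and `f x⋆x f ≤ ‖x‖² f²`. -/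
theorem IsPeakState.norm_apply_le {f : A} {φ : A →ₗ[ℂ] ℂ} (h : IsPeakState f φ) (hf : 0 ≤ f)
    (x : A) : ‖φ x‖ ≤ ‖x‖ := by
  have h1 := LinearMap.norm_apply_star_mul_sq_le h.nonneg f x
  rw [(IsSelfAdjoint.of_nonneg hf).star_eq, h.map_left, h.map_left, h.map_self] at h1
  have h2 : φ (star x * x) ≤ ((‖x‖ ^ 2 : ℝ) : ℂ) := by
    have h3 : star f * (star x * x) * f ≤ ‖star x * x‖ • (star f * f) :=
      CStarAlgebra.star_left_conjugate_le_norm_smul (.star_mul_self x)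
    have h4 := h.nonneg _ (sub_nonneg.2 h3)
    rw [(IsSelfAdjoint.of_nonneg hf).star_eq, map_sub, h.map_right, h.map_left, ← Complex.coe_smul,
      map_smul, h.map_left, h.map_self, CStarRing.norm_star_mul_self] at h4
    simpa [sq] using h4
  have h5 := (Complex.le_def.1 h2).1
  simp only [Complex.ofReal_re, Complex.one_re, one_mul] at h1 h5
  exact le_of_sq_le_sq (h1.trans h5) (norm_nonneg x)

end PositiveFunctionals

theorem le_of_forall_pow_two_pow_le {x y M : ℝ} (hy : 0 ≤ y)
    (h : ∀ n : ℕ, x ^ 2 ^ n ≤ M * y ^ 2 ^ n) : x ≤ y := by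
  by_contra! hlt
  have hx : 0 < x := hy.trans_lt hlt
  rcases hy.eq_or_lt with rfl | hy
  · have := h 0
    simp at this
    exact absurd hx this.not_gt
  · obtain ⟨N, hN⟩ := pow_unbounded_of_one_lt M ((one_lt_div hy).2 hlt)
    have h1 := h N
    rw [← div_le_iff₀ (by positivity), ← div_pow] at h1
    have h2 : (x / y) ^ N ≤ (x / y) ^ 2 ^ N :=
      pow_le_pow_right₀ ((one_lt_div hy).2 hlt).le Nat.lt_two_pow_self.le
    linarith

theorem tmul_ne_zero_of_ne_zero {V W : Type*} [NormedAddCommGroup V] [NormedSpace ℂ V]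
    [NormedAddCommGroup W] [NormedSpace ℂ W] {v : V} {w : W} (hv : v ≠ 0) (hw : w ≠ 0) :
    v ⊗ₜ[ℂ] w ≠ 0 := by
  obtain ⟨f, -, hf⟩ := exists_dual_vector ℂ v (norm_ne_zero_iff.2 hv)
  obtain ⟨g, -, hg⟩ := exists_dual_vector ℂ w (norm_ne_zero_iff.2 hw)
  intro h
  have := congrArg (TensorProduct.lid ℂ ℂ ∘ TensorProduct.map f.toLinearMap g.toLinearMap) h
  simp [hf, hg, hv, hw] at this

/-- A bump function at the top of the spectrum of a positive element. -/
theorem exists_nonneg_ne_zero_smul_le_mul {A : Type*} [NonUnitalCStarAlgebra A] [PartialOrder A]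
    [StarOrderedRing A] {a : A} (ha : 0 ≤ a) {r : ℝ} (hr : 0 ≤ r) (hra : r < ‖a‖) :
    ∃ a' : A, 0 ≤ a' ∧ a' ≠ 0 ∧ 0 ≤ a * a' ∧ r • a' ≤ a * a' := by
  have hsa : IsSelfAdjoint a := .of_nonneg ha
  -- This vanishes on `[0, r]`, so `r * g t ≤ t * g t`, and it is nonzero at `‖a‖`, a point of the
  -- quasispectrum.
  let g : ℝ → ℝ := fun t => max (t - r) 0
  have hg : Continuous g := by fun_prop
  have hg0 : g 0 = 0 := by simp [g, hr]
  have hmul : a * cfcₙ g a = cfcₙ (fun t => t * g t) a := by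
    rw [cfcₙ_mul (fun t : ℝ => t) g a (by fun_prop) (by simp) (by fun_prop) hg0, cfcₙ_id' ℝ a]
  have hsmul : r • cfcₙ g a = cfcₙ (fun t => r • g t) a := (cfcₙ_smul r g a (by fun_prop) hg0).symm
  refine ⟨cfcₙ g a, cfcₙ_nonneg fun x _ => le_max_right _ _, ?_, ?_, ?_⟩
  · obtain ⟨x, hx, hxa⟩ := (NonUnitalIsometricContinuousFunctionalCalculus.isGreatest_norm_quasispectrum (𝕜 := ℝ) a).1
    have hx0 : 0 ≤ x := quasispectrum_nonneg_of_nonneg a ha x hx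
    simp only [Real.norm_of_nonneg hx0] at hxa
    have h1 := norm_apply_le_norm_cfcₙ g a hx
      (by fun_prop) hg0
    rw [← norm_pos_iff]
    refine lt_of_lt_of_le ?_ h1
    rw [norm_pos_iff]
    refine (lt_max_of_lt_left ?_).ne'
    rw [hxa]
    linarith
  · rw [hmul]
    exact cfcₙ_nonneg fun x hx =>
      mul_nonneg (quasispectrum_nonneg_of_nonneg a ha x hx) (le_max_right _ _)
  · rw [hmul, hsmul]
    refine cfcₙ_mono (fun x _ => ?_) (by fun_prop) (by fun_prop) (by simp [hg0]) (by simp)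
    simp only [g, smul_eq_mul]
    rcases le_total (x - r) 0 with h | h
    · simp [h]
    · rw [max_eq_left h]
      nlinarith

/-! ### Every C⋆-norm is a cross norm. -/

section Cross

variable {A E F : Type*} [NonUnitalCStarAlgebra A] [NonUnitalCStarAlgebra E]
  [NonUnitalCStarAlgebra F] (T : E ⊗[ℂ] F →⋆ₙₐ[ℂ] A)

namespace TensorRep

theorem star_mul_self (a : E) (b : F) :
    star (T (a ⊗ₜ b)) * T (a ⊗ₜ b) = T ((star a * a) ⊗ₜ (star b * b)) := by
  rw [← map_star, ← map_mul, TensorProduct.star_tmul, Algebra.TensorProduct.tmul_mul_tmul]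

theorem norm_sq (a : E) (b : F) :
    ‖T (a ⊗ₜ b)‖ ^ 2 = ‖T ((star a * a) ⊗ₜ (star b * b))‖ := by
  rw [← star_mul_self, CStarRing.norm_star_mul_self, sq]

variable [PartialOrder A] [StarOrderedRing A] [PartialOrder E] [StarOrderedRing E]
  [PartialOrder F] [StarOrderedRing F]

theorem nonneg {a : E} {b : F} (ha : 0 ≤ a) (hb : 0 ≤ b) : 0 ≤ T (a ⊗ₜ b) := by
  obtain ⟨c, rfl⟩ := CStarAlgebra.nonneg_iff_eq_star_mul_self.1 ha
  obtain ⟨d, rfl⟩ := CStarAlgebra.nonneg_iff_eq_star_mul_self.1 hb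
  rw [← star_mul_self]
  exact star_mul_self_nonneg _

/-- Positive maps between C⋆-algebras are automatically bounded; the C⋆-identity passes from `b` to
the positive element `b⋆b`. -/
theorem exists_bound_left (b : F) : ∃ C : ℝ, ∀ a : E, ‖T (a ⊗ₜ b)‖ ≤ C * ‖a‖ := by
  let f : E →ₗ[ℂ] A := (T : E ⊗[ℂ] F →ₗ[ℂ] A) ∘ₗ (TensorProduct.mk ℂ E F).flip (star b * b)
  obtain ⟨C, hC⟩ := PositiveLinearMap.exists_norm_apply_le
    (PositiveLinearMap.mk₀ f fun x hx => nonneg T hx (star_mul_self_nonneg b))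
  refine ⟨√C, fun a => ?_⟩
  refine le_of_sq_le_sq ?_ (by positivity)
  rw [norm_sq, mul_pow, Real.sq_sqrt C.coe_nonneg]
  refine (hC _).trans ?_
  rw [CStarRing.norm_star_mul_self, sq]

theorem exists_bound_right (a : E) : ∃ C : ℝ, ∀ b : F, ‖T (a ⊗ₜ b)‖ ≤ C * ‖b‖ := by
  let f : F →ₗ[ℂ] A := (T : E ⊗[ℂ] F →ₗ[ℂ] A) ∘ₗ (TensorProduct.mk ℂ E F) (star a * a)
  obtain ⟨C, hC⟩ := PositiveLinearMap.exists_norm_apply_le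
    (PositiveLinearMap.mk₀ f fun x hx => nonneg T (star_mul_self_nonneg a) hx)
  refine ⟨√C, fun b => ?_⟩
  refine le_of_sq_le_sq ?_ (by positivity)
  rw [norm_sq, mul_pow, Real.sq_sqrt C.coe_nonneg]
  refine (hC _).trans ?_
  rw [CStarRing.norm_star_mul_self, sq]

theorem exists_bound : ∃ M : ℝ, ∀ (a : E) (b : F), ‖T (a ⊗ₜ b)‖ ≤ M * (‖a‖ * ‖b‖) := by
  let f (b : F) : E →ₗ[ℂ] A := (T : E ⊗[ℂ] F →ₗ[ℂ] A) ∘ₗ (TensorProduct.mk ℂ E F).flip b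
  let g (b : Metric.closedBall (0 : F) 1) : E →L[ℂ] A :=
    (f b).mkContinuousOfExistsBound (exists_bound_left T b)
  obtain ⟨M, hM⟩ := banach_steinhaus (g := g) fun a => by
    obtain ⟨C, hC⟩ := exists_bound_right T a
    refine ⟨|C|, fun b => (hC b).trans ?_⟩
    have hb : ‖(b : F)‖ ≤ 1 := mem_closedBall_zero_iff.1 b.2
    calc C * ‖(b : F)‖ ≤ |C| * 1 := by gcongr; exact le_abs_self C
      _ = |C| := mul_one _
  refine ⟨M, fun a b => ?_⟩
  rcases eq_or_ne b 0 with rfl | hb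
  · simp
  have hb' := norm_pos_iff.2 hb
  let u : F := (‖b‖⁻¹ : ℂ) • b
  have hu : ‖u‖ = 1 := by simp [u, norm_smul, hb'.ne']
  have h1 : ‖T (a ⊗ₜ u)‖ ≤ M * ‖a‖ :=
    ((g ⟨u, by simp [hu]⟩).le_opNorm a).trans (by gcongr; exact hM _)
  have h2 : b = (‖b‖ : ℂ) • u := by
    simp [u, smul_smul, hb]
  calc ‖T (a ⊗ₜ b)‖ = ‖b‖ * ‖T (a ⊗ₜ u)‖ := by
        conv_lhs => rw [h2, TensorProduct.tmul_smul, map_smul, norm_smul]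
        simp
    _ ≤ ‖b‖ * (M * ‖a‖) := by gcongr
    _ = _ := by ring

/-- Iterating the C⋆-identity raises all norms to the power `2 ^ n` while `M` stays fixed, so `M`
can be replaced by one. -/
theorem norm_le (a : E) (b : F) : ‖T (a ⊗ₜ b)‖ ≤ ‖a‖ * ‖b‖ := by
  obtain ⟨M, hM⟩ := exists_bound T
  refine le_of_forall_pow_two_pow_le (M := M) (by positivity) fun n => ?_
  induction n generalizing a b with
  | zero => simpa using hM a b
  | succ n ih =>
    have := ih (star a * a) (star b * b)
    rw [← norm_sq, CStarRing.norm_star_mul_self, CStarRing.norm_star_mul_self, ← pow_mul,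
      ← pow_succ'] at this
    refine this.trans_eq ?_
    rw [pow_succ' 2 n, pow_mul]
    ring

variable {T} (hT : Function.Injective T)

include hT

/-- For `r < ‖a‖` and `s < ‖b‖`, multiplication by bumps `a'`, `b'` at the tops of the spectra gives
`rs T(a' ⊗ b') ≤ T(aa' ⊗ bb')`. Injectivity of `T` allows division by `‖T(a' ⊗ b')‖`. -/
theorem le_norm_of_nonneg {a : E} {b : F} (ha : 0 ≤ a) (hb : 0 ≤ b) :
    ‖a‖ * ‖b‖ ≤ ‖T (a ⊗ₜ b)‖ := by
  rcases eq_or_ne a 0 with rfl | ha0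
  · simp
  rcases eq_or_ne b 0 with rfl | hb0
  · simp
  have ha1 := norm_pos_iff.2 ha0
  have hb1 := norm_pos_iff.2 hb0
  have key (t : ℝ) (ht : t ∈ Set.Ioo (0 : ℝ) 1) : (t * ‖a‖) * (t * ‖b‖) ≤ ‖T (a ⊗ₜ b)‖ := by
    have hr : 0 ≤ t * ‖a‖ := mul_nonneg ht.1.le ha1.le
    have hs : 0 ≤ t * ‖b‖ := mul_nonneg ht.1.le hb1.le
    obtain ⟨a', ha', ha0', haa', hle⟩ := exists_nonneg_ne_zero_smul_le_mul ha hr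
      (by nlinarith [ht.2])
    obtain ⟨b', hb', hb0', hbb', hle'⟩ := exists_nonneg_ne_zero_smul_le_mul hb hs
      (by nlinarith [ht.2])
    set r := t * ‖a‖
    set s := t * ‖b‖
    have hpos : 0 < ‖T (a' ⊗ₜ b')‖ := norm_pos_iff.2 fun h =>
      tmul_ne_zero_of_ne_zero ha0' hb0' (hT (h.trans (map_zero T).symm))
    have h1 : (r * s) • T (a' ⊗ₜ b') ≤ T ((a * a') ⊗ₜ (b * b')) := by
      have e1 := nonneg T (sub_nonneg.2 hle) hbb'
      have e2 := nonneg T (smul_nonneg hr ha') (sub_nonneg.2 hle')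
      have e3 : T ((a * a') ⊗ₜ (b * b')) - (r * s) • T (a' ⊗ₜ b')
          = T ((a * a' - r • a') ⊗ₜ (b * b')) + T ((r • a') ⊗ₜ (b * b' - s • b')) := by
        simp only [← Complex.coe_smul, TensorProduct.sub_tmul, TensorProduct.tmul_sub,
          TensorProduct.tmul_smul, ← TensorProduct.smul_tmul', map_sub, map_smul, smul_smul]
        push_cast
        rw [mul_comm (s : ℂ)]
        abel
      rw [← sub_nonneg, e3]
      exact add_nonneg e1 e2
    have h2 := CStarAlgebra.norm_le_norm_of_nonneg_of_le
      (smul_nonneg (mul_nonneg hr hs) (nonneg T ha' hb')) h1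
    rw [norm_smul, Real.norm_of_nonneg (mul_nonneg hr hs),
      ← Algebra.TensorProduct.tmul_mul_tmul, map_mul] at h2
    exact le_of_mul_le_mul_right (h2.trans (norm_mul_le _ _)) hpos
  have hlim : Tendsto (fun t : ℝ => (t * ‖a‖) * (t * ‖b‖)) (𝓝[<] 1) (𝓝 (‖a‖ * ‖b‖)) := by
    have : Continuous fun t : ℝ => (t * ‖a‖) * (t * ‖b‖) := by fun_prop
    simpa using (this.tendsto 1).mono_left nhdsWithin_le_nhds
  exact le_of_tendsto hlim (by
    filter_upwards [Ioo_mem_nhdsLT (zero_lt_one (α := ℝ))] with t ht using key t ht)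

theorem norm_eq (a : E) (b : F) : ‖T (a ⊗ₜ b)‖ = ‖a‖ * ‖b‖ := by
  refine le_antisymm (norm_le T a b) (le_of_sq_le_sq ?_ (norm_nonneg _))
  rw [norm_sq, mul_pow, sq, sq, ← CStarRing.norm_star_mul_self, ← CStarRing.norm_star_mul_self]
  exact le_norm_of_nonneg hT (star_mul_self_nonneg a) (star_mul_self_nonneg b)

end TensorRep

end Cross

/-! ### Pure peak states. -/

section Pure

variable {E : Type*} [NonUnitalCStarAlgebra E] [PartialOrder E] [StarOrderedRing E]

theorem mul_self_le_self_of_norm_le_one {h : E} (h0 : 0 ≤ h) (h1 : ‖h‖ ≤ 1) : h * h ≤ h := by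
  have hs := CFC.sqrt_mul_sqrt_self h h0
  have hstar : star (CFC.sqrt h) = CFC.sqrt h :=
    (IsSelfAdjoint.of_nonneg (CFC.sqrt_nonneg h)).star_eq
  have h2 : star (CFC.sqrt h) * h * CFC.sqrt h ≤ ‖h‖ • (star (CFC.sqrt h) * CFC.sqrt h) :=
    CStarAlgebra.star_left_conjugate_le_norm_smul (.of_nonneg h0)
  rw [hstar, hs] at h2
  calc h * h = CFC.sqrt h * h * CFC.sqrt h := by
        have (s : E) (e : s * s = h) : h * h = s * h * s := by rw [← e]; simp only [mul_assoc]
        exact this _ hs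
    _ ≤ ‖h‖ • h := h2
    _ ≤ (1 : ℝ) • h := smul_le_smul_of_nonneg_right h1 h0
    _ = h := one_smul _ _

/-- In the topology of pointwise convergence the defining conditions are closed, and
`IsPeakState.norm_apply_le` confines the set to a product of discs. -/
theorem isCompact_peakStates {f : E} (hf : 0 ≤ f) :
    IsCompact {g : E → ℂ | ∃ φ, IsPeakState f φ ∧ ⇑φ = g} := by
  refine IsCompact.of_isClosed_subset
    (isCompact_univ_pi fun x : E => isCompact_closedBall (0 : ℂ) ‖x‖) ?_ ?_
  · have : {g : E → ℂ | ∃ φ, IsPeakState f φ ∧ ⇑φ = g} =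
        Set.range ((↑) : (E →ₗ[ℂ] ℂ) → E → ℂ) ∩
        (({g | ∀ x, 0 ≤ x → 0 ≤ g x} ∩ {g | ∀ x, g (f * x) = g x}) ∩
        ({g | ∀ x, g (x * f) = g x} ∩ {g | g f = 1})) := by
      ext g
      constructor
      · rintro ⟨φ, h, rfl⟩
        exact ⟨⟨φ, rfl⟩, ⟨h.nonneg, h.map_left⟩, h.map_right, h.map_self⟩
      · rintro ⟨⟨φ, rfl⟩, ⟨h1, h2⟩, h3, h4⟩
        exact ⟨φ, ⟨h1, h2, h3, h4⟩, rfl⟩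
    rw [this]
    refine (LinearMap.isClosed_range_coe E ℂ (RingHom.id ℂ)).inter ((IsClosed.inter ?_ ?_).inter
      (IsClosed.inter ?_ ?_))
    · simp only [Set.ofPred_forall]
      exact isClosed_iInter fun x => isClosed_iInter fun _ =>
        isClosed_le continuous_const (continuous_apply x)
    · simp only [Set.ofPred_forall]
      exact isClosed_iInter fun x => isClosed_eq (continuous_apply _) (continuous_apply _)
    · simp only [Set.ofPred_forall]
      exact isClosed_iInter fun x => isClosed_eq (continuous_apply _) (continuous_apply _)
    · exact isClosed_eq (continuous_apply _) continuous_const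
  · rintro _ ⟨φ, h, rfl⟩ x -
    simpa using h.norm_apply_le hf x

/-- A positive functional dominated by a peak state at `f` is concentrated where `f` is equal
to one. -/
theorem IsPeakState.map_left_of_le {f : E} (hf : 0 ≤ f) {φ τ : E →ₗ[ℂ] ℂ} (h : IsPeakState f φ)
    (hτ : ∀ x, 0 ≤ x → 0 ≤ τ x) (hle : ∀ x, 0 ≤ x → τ x ≤ φ x) (x : E) : τ (f * x) = τ x := by
  have hfs : star f = f := (IsSelfAdjoint.of_nonneg hf).star_eq
  suffices τ ∘ₗ LinearMap.mulLeft ℂ f = τ from LinearMap.congr_fun this x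
  refine LinearMap.eq_of_forall_nonneg fun x hx => ?_
  obtain ⟨y, rfl⟩ := CStarAlgebra.nonneg_iff_eq_star_mul_self.1 hx
  -- `φ` vanishes on `(y - yf)⋆(y - yf)`, hence so does the smaller `τ`.
  have h1 := LinearMap.norm_apply_star_mul_sq_le hτ (y - y * f) y
  have h2 : φ (star (y - y * f) * (y - y * f)) = 0 := by
    rw [mul_sub, map_sub, ← mul_assoc, h.map_right, sub_self]
  have h3 : τ (star (y - y * f) * (y - y * f)) = 0 :=
    le_antisymm ((hle _ (star_mul_self_nonneg _)).trans_eq h2) (hτ _ (star_mul_self_nonneg _))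
  rw [h3, Complex.zero_re, zero_mul, star_sub, star_mul, hfs, sub_mul, map_sub, mul_assoc] at h1
  have h4 : τ (star y * y) - τ (f * (star y * y)) = 0 := by
    simpa using le_antisymm h1 (sq_nonneg _)
  exact (sub_eq_zero.1 h4).symm

theorem LinearMap.map_star_of_nonneg {τ : E →ₗ[ℂ] ℂ} (hτ : ∀ x, 0 ≤ x → 0 ≤ τ x) (x : E) :
    τ (star x) = star (τ x) :=
  map_star (PositiveLinearMap.mk₀ τ hτ) x

theorem IsPeakState.map_right_of_le {f : E} (hf : 0 ≤ f) {φ τ : E →ₗ[ℂ] ℂ} (h : IsPeakState f φ)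
    (hτ : ∀ x, 0 ≤ x → 0 ≤ τ x) (hle : ∀ x, 0 ≤ x → τ x ≤ φ x) (x : E) : τ (x * f) = τ x := by
  have hfs : star f = f := (IsSelfAdjoint.of_nonneg hf).star_eq
  have := h.map_left_of_le hf hτ hle (star x)
  rw [LinearMap.map_star_of_nonneg hτ, ← hfs, ← star_mul, LinearMap.map_star_of_nonneg hτ] at this
  exact star_injective this

/-- Peak states that are pure. -/
theorem exists_pure_isPeakState {f : E} (hf : 0 ≤ f) (hf1 : ‖f‖ = 1) :
    ∃ φ : E →ₗ[ℂ] ℂ, IsPeakState f φ ∧ ∀ τ : E →ₗ[ℂ] ℂ, (∀ x, 0 ≤ x → 0 ≤ τ x) →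
      (∀ x, 0 ≤ x → τ x ≤ φ x) → τ = τ f • φ := by
  obtain ⟨ω, -, hω⟩ := exists_dual_isPeakState hf hf1
  obtain ⟨g, ⟨φ, hφ, rfl⟩, hext⟩ := (isCompact_peakStates hf).extremePoints_nonempty
    ⟨_, ω.toLinearMap, hω, rfl⟩
  refine ⟨φ, hφ, fun τ hτ hle => ?_⟩
  have hc0 : 0 ≤ τ f := hτ f hf
  have hc1 : τ f ≤ 1 := hφ.map_self ▸ hle f hf
  have hl := hφ.map_left_of_le hf hτ hle
  have hr := hφ.map_right_of_le hf hτ hle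
  -- `φ` is the midpoint of the peak states `φ₁` and `φ₂`; extremality gives `φ₁ = φ`, which is the
  -- claim.
  let φ₁ := (1 - τ f) • φ + τ
  let φ₂ := (1 + τ f) • φ - τ
  have h1 : IsPeakState f φ₁ := by
    refine ⟨fun x hx => ?_, fun x => ?_, fun x => ?_, ?_⟩
    · exact add_nonneg (mul_nonneg (sub_nonneg.2 hc1) (hφ.nonneg x hx)) (hτ x hx)
    · simp [φ₁, hl, hφ.map_left]
    · simp [φ₁, hr, hφ.map_right]
    · simp [φ₁, hφ.map_self]
  have h2 : IsPeakState f φ₂ := by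
    refine ⟨fun x hx => ?_, fun x => ?_, fun x => ?_, ?_⟩
    · have e : φ₂ x = (φ x - τ x) + τ f * φ x := by simp [φ₂]; ring
      rw [e]
      exact add_nonneg (sub_nonneg.2 (hle x hx)) (mul_nonneg hc0 (hφ.nonneg x hx))
    · simp [φ₂, hl, hφ.map_left]
    · simp [φ₂, hr, hφ.map_right]
    · simp [φ₂, hφ.map_self]
  have := hext ⟨φ₁, h1, rfl⟩ ⟨φ₂, h2, rfl⟩ ⟨1 / 2, 1 / 2, by norm_num, by norm_num, by norm_num, by
    ext x
    simp [φ₁, φ₂]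
    ring⟩
  ext x
  have hx := congrFun this x
  simp [φ₁] at hx ⊢
  linear_combination hx

end Pure

/-! ### Product functionals and slice maps. -/

section Slice

variable {A E F : Type*} [NonUnitalCStarAlgebra A] [NonUnitalCStarAlgebra E]
  [NonUnitalCStarAlgebra F] {T : E ⊗[ℂ] F →⋆ₙₐ[ℂ] A}
  [PartialOrder A] [StarOrderedRing A] [PartialOrder E] [StarOrderedRing E]
  [PartialOrder F] [StarOrderedRing F]

namespace TensorRep

/-- A pure peak state on the first factor extends to a product functional that peaks at a given
positive element of the second factor. -/
theorem exists_product_extension (hT : Function.Injective T) {f : E} (hf : 0 ≤ f) (hf1 : ‖f‖ = 1)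
    {φ : E →ₗ[ℂ] ℂ} (hφ : IsPeakState f φ)
    (hpure : ∀ τ : E →ₗ[ℂ] ℂ, (∀ x, 0 ≤ x → 0 ≤ τ x) → (∀ x, 0 ≤ x → τ x ≤ φ x) → τ = τ f • φ)
    {b : F} (hb : 0 ≤ b) (hb1 : ‖b‖ = 1) :
    ∃ ω : StrongDual ℂ A, ‖ω‖ ≤ 1 ∧ ω (T (f ⊗ₜ b)) = 1 ∧
      ∀ a y, ω (T (a ⊗ₜ y)) = φ a * ω (T (f ⊗ₜ y)) := by
  obtain ⟨ω, hω, hext⟩ := exists_dual_of_forall_norm_le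
    ((T : E ⊗[ℂ] F →ₗ[ℂ] A) ∘ₗ (TensorProduct.mk ℂ E F).flip b) φ zero_le_one (fun a => by
      have : ‖T (a ⊗ₜ b)‖ = ‖a‖ := by rw [norm_eq hT, hb1, mul_one]
      simpa [this] using hφ.norm_apply_le hf a)
  have hext (a : E) : ω (T (a ⊗ₜ b)) = φ a := hext a
  have hfb : ω (T (f ⊗ₜ b)) = 1 := (hext f).trans hφ.map_self
  have hω' : IsPeakState (T (f ⊗ₜ b)) ω.toLinearMap :=
    isPeakState_of_norm_le_one hω (nonneg T hf hb) (by rw [norm_eq hT, hf1, hb1, mul_one]) hfb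
  refine ⟨ω, hω, hfb, fun a y => ?_⟩
  let τ (y : F) : E →ₗ[ℂ] ℂ :=
    ω.toLinearMap ∘ₗ (T : E ⊗[ℂ] F →ₗ[ℂ] A) ∘ₗ (TensorProduct.mk ℂ E F).flip y
  have hτ_def (a : E) (y : F) : τ y a = ω (T (a ⊗ₜ y)) := rfl
  have hbb : b * b ≤ b := mul_self_le_self_of_norm_le_one hb hb1.le
  -- Since `ω` peaks at `f ⊗ b`, `y` may be replaced by `byb ≤ b`, and `ω` restricts to `φ` along
  -- `b`. So `τ y ≤ φ`, and purity applies.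
  have hτ (y : F) (hy : 0 ≤ y) (hy1 : ‖y‖ ≤ 1) : τ y = τ y f • φ := by
    refine hpure (τ y) (fun a ha => hω'.nonneg _ (nonneg T ha hy)) fun a ha => ?_
    have h1 : τ y a = ω (T ((f * a * f) ⊗ₜ (b * y * b))) := by
      rw [hτ_def, ← Algebra.TensorProduct.tmul_mul_tmul, ← Algebra.TensorProduct.tmul_mul_tmul,
        map_mul T, map_mul T]
      exact ((hω'.map_right _).trans (hω'.map_left _)).symm
    have h2 : b * y * b ≤ b := by
      have h3 : star b * y * b ≤ ‖y‖ • (star b * b) :=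
        CStarAlgebra.star_left_conjugate_le_norm_smul (.of_nonneg hy)
      rw [(IsSelfAdjoint.of_nonneg hb).star_eq] at h3
      refine h3.trans (le_trans ?_ hbb)
      have h4 : 0 ≤ b * b := by
        simpa [(IsSelfAdjoint.of_nonneg hb).star_eq] using star_mul_self_nonneg b
      simpa using smul_le_smul_of_nonneg_right hy1 h4
    have h3 : 0 ≤ f * a * f := by
      have := star_left_conjugate_nonneg ha f
      rwa [(IsSelfAdjoint.of_nonneg hf).star_eq] at this
    have h4 := hω'.nonneg _ (nonneg T h3 (sub_nonneg.2 h2))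
    rw [TensorProduct.tmul_sub, map_sub, map_sub] at h4
    rw [h1, ← hφ.map_left, ← hφ.map_right, ← hext]
    exact sub_nonneg.1 h4
  have hlin : (TensorProduct.mk ℂ E F).compr₂ (ω.toLinearMap ∘ₗ (T : E ⊗[ℂ] F →ₗ[ℂ] A)) a =
      φ a • (TensorProduct.mk ℂ E F).compr₂ (ω.toLinearMap ∘ₗ (T : E ⊗[ℂ] F →ₗ[ℂ] A)) f := by
    refine LinearMap.eq_of_forall_nonneg fun y hy => ?_
    rcases eq_or_ne y 0 with rfl | hy0
    · simp
    have hy' : (‖y‖ : ℂ) ≠ 0 := by simpa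
    have := LinearMap.congr_fun (hτ ((‖y‖⁻¹ : ℝ) • y) (smul_nonneg (by positivity) hy)
      (by simp [norm_smul, hy0])) a
    simp only [LinearMap.smul_apply, hτ_def, ← Complex.coe_smul, TensorProduct.tmul_smul, map_smul,
      smul_eq_mul] at this
    push_cast at this
    simp
    field_simp at this
    rw [this]
    ring
  simpa using LinearMap.congr_fun hlin y

/-- The slice map of a pure peak state is contractive. -/
theorem norm_slice_le (hT : Function.Injective T) {f : E} (hf : 0 ≤ f) (hf1 : ‖f‖ = 1)
    {φ : E →ₗ[ℂ] ℂ} (hφ : IsPeakState f φ)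
    (hpure : ∀ τ : E →ₗ[ℂ] ℂ, (∀ x, 0 ≤ x → 0 ≤ τ x) → (∀ x, 0 ≤ x → τ x ≤ φ x) → τ = τ f • φ)
    (x : E ⊗[ℂ] F) : ‖TensorProduct.lid ℂ F (TensorProduct.map φ LinearMap.id x)‖ ≤ ‖T x‖ := by
  set y := TensorProduct.lid ℂ F (TensorProduct.map φ LinearMap.id x) with hy
  rcases eq_or_ne y 0 with hy0 | hy0
  · rw [hy0, norm_zero]
    exact norm_nonneg _
  have hpos := norm_pos_iff.2 hy0
  -- Peaking at `yy⋆ / ‖y‖²` is chosen because `x (f ⊗ y⋆)` has slice `yy⋆`: `ω` then returns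
  -- `‖y‖²`, against the bound `‖T x‖ ‖y‖`.
  obtain ⟨ω, hω, hfb, hprod⟩ := exists_product_extension hT hf hf1 hφ hpure
    (b := (‖y‖ ^ 2)⁻¹ • (y * star y)) (smul_nonneg (by positivity) (mul_star_self_nonneg y))
    (by rw [norm_smul, CStarRing.norm_self_mul_star, ← sq]; simp [hpos.ne'])
  have h1 (z : E ⊗[ℂ] F) : ω (T (z * (f ⊗ₜ star y))) =
      ω (T (f ⊗ₜ (TensorProduct.lid ℂ F (TensorProduct.map φ LinearMap.id z) * star y))) := by
    induction z with
    | zero => simp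
    | tmul a c =>
      rw [Algebra.TensorProduct.tmul_mul_tmul, hprod, hφ.map_right]
      simp [smul_mul_assoc]
    | add z w hz hw => rw [add_mul, map_add, map_add, hz, hw]; simp [add_mul, TensorProduct.tmul_add]
  have h2 : ω (T (f ⊗ₜ (y * star y))) = ((‖y‖ ^ 2 : ℝ) : ℂ) := by
    rw [← Complex.coe_smul, TensorProduct.tmul_smul, map_smul, map_smul, smul_eq_mul] at hfb
    push_cast at hfb ⊢
    have : (‖y‖ : ℂ) ≠ 0 := by simpa
    field_simp at hfb
    exact hfb
  have h3 : ‖y‖ ^ 2 ≤ ‖T x‖ * ‖y‖ := by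
    have e := h1 x
    rw [← hy, h2] at e
    calc ‖y‖ ^ 2 = ‖ω (T (x * (f ⊗ₜ star y)))‖ := by
          rw [e, Complex.norm_real, Real.norm_of_nonneg (by positivity)]
      _ ≤ 1 * ‖T (x * (f ⊗ₜ star y))‖ := (ω.le_opNorm _).trans (by gcongr)
      _ ≤ ‖T x‖ * ‖T (f ⊗ₜ star y)‖ := by rw [one_mul, map_mul]; exact norm_mul_le _ _
      _ = ‖T x‖ * ‖y‖ := by rw [norm_eq hT, hf1, one_mul, norm_star]
  rw [sq] at h3
  exact le_of_mul_le_mul_right h3 hpos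

end TensorRep

end Slice

/-! ### Orthogonal sequences in infinite-dimensional C⋆-algebras. -/

section Atoms

variable {E : Type*} [NonUnitalCStarAlgebra E]

/-- `a` is below `h` if every left annihilator of `h` annihilates `a`. -/
def SupportLE (a h : E) : Prop := ∀ d : E, d * h = 0 → d * a = 0

theorem SupportLE.refl (h : E) : SupportLE h h := fun _ => id

theorem SupportLE.trans {a b c : E} (hab : SupportLE a b) (hbc : SupportLE b c) : SupportLE a c :=
  fun d hd => hab d (hbc d hd)

theorem SupportLE.sub {a b h : E} (ha : SupportLE a h) (hb : SupportLE b h) :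
    SupportLE (a - b) h := fun d hd => by rw [mul_sub, ha d hd, hb d hd, sub_zero]

theorem SupportLE.smul {a h : E} (ha : SupportLE a h) (c : ℝ) : SupportLE (c • a) h :=
  fun d hd => by rw [mul_smul_comm, ha d hd, smul_zero]

theorem SupportLE.mul {a h : E} (ha : SupportLE a h) (x : E) : SupportLE (a * x) h :=
  fun d hd => by rw [← mul_assoc, ha d hd, zero_mul]

/-- From `dx = 0` follows `dx⁺ = dx⁻`, so `(dx⁺)(dx⁺)⋆ = d x⁻ x⁺ d⋆ = 0`. -/
theorem supportLE_posPart {x : E} (hx : IsSelfAdjoint x) : SupportLE x⁺ x := fun d hd => by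
  let _ := CStarAlgebra.spectralOrder E
  have := CStarAlgebra.spectralOrderedRing E
  have h1 : d * x⁺ = d * x⁻ := by
    rw [← sub_eq_zero, ← mul_sub, CFC.posPart_sub_negPart x hx, hd]
  have h2 : star x⁺ = x⁺ := (IsSelfAdjoint.of_nonneg (CFC.posPart_nonneg x)).star_eq
  rw [← CStarRing.mul_star_self_eq_zero_iff, star_mul, h2, h1, mul_assoc, ← mul_assoc x⁻,
    CFC.negPart_mul_posPart, zero_mul, mul_zero]

theorem supportLE_negPart {x : E} (hx : IsSelfAdjoint x) : SupportLE x⁻ x := fun d hd => by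
  have h1 : d * x⁺ - d * x⁻ = 0 := by rw [← mul_sub, CFC.posPart_sub_negPart x hx, hd]
  rwa [supportLE_posPart hx d hd, zero_sub, neg_eq_zero] at h1

/-- Minimal projections. -/
structure IsMinimalProjection (p : E) : Prop where
  proj : IsStarProjection p
  ne_zero : p ≠ 0
  exists_smul : ∀ x, ∃ c : ℂ, p * x * p = c • p

/-- A pairwise orthogonal sequence of nonzero positive elements. -/
def HasOrthogonalSequence (E : Type*) [NonUnitalCStarAlgebra E] : Prop :=
  ∃ f : ℕ → E, (∀ n, ∃ x, f n = star x * x) ∧ (∀ n, f n ≠ 0) ∧ ∀ m n, m ≠ n → f m * f n = 0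

section Order

variable [PartialOrder E] [StarOrderedRing E]

theorem nonneg_or_nonpos_of_supportLE {h : E}
    (hs : ∀ a b : E, 0 ≤ a → 0 ≤ b → SupportLE a h → SupportLE b h → a * b = 0 → a = 0 ∨ b = 0)
    {x : E} (hx : IsSelfAdjoint x) (hxh : SupportLE x h) : 0 ≤ x ∨ x ≤ 0 := by
  rcases hs _ _ (CFC.posPart_nonneg x) (CFC.negPart_nonneg x) ((supportLE_posPart hx).trans hxh)
    ((supportLE_negPart hx).trans hxh) (CFC.posPart_mul_negPart x) with h | h
  · right
    rwa [CFC.posPart_eq_zero_iff x hx] at h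
  · left
    rwa [CFC.negPart_eq_zero_iff x hx] at h

theorem norm_le_of_nonneg_sub_smul {p x : E} (hp : 0 ≤ p) (hp1 : ‖p‖ = 1) {c : ℝ}
    (hc : c • p ≤ x) : c ≤ ‖x‖ := by
  rcases le_total c 0 with h | h
  · exact h.trans (norm_nonneg x)
  · have := CStarAlgebra.norm_le_norm_of_nonneg_of_le (smul_nonneg h hp) hc
    rwa [norm_smul, hp1, mul_one, Real.norm_of_nonneg h] at this

/-- Without splitting, each self-adjoint element below `h` has a sign. Comparing `h²` with `ch` for
`c < 1` gives `h² = h`; comparing `hxh` with all real multiples of `h` shows that it is one of them.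
-/
theorem isMinimalProjection_of_not_split {h : E} (h0 : 0 ≤ h) (h1 : ‖h‖ = 1)
    (hs : ∀ a b : E, 0 ≤ a → 0 ≤ b → SupportLE a h → SupportLE b h → a * b = 0 → a = 0 ∨ b = 0) :
    IsMinimalProjection h := by
  have hsa : IsSelfAdjoint h := .of_nonneg h0
  have hhsa : IsSelfAdjoint (h * h) := by
    simpa [hsa.star_eq] using IsSelfAdjoint.star_mul_self h
  have hmul : h * h = h := by
    refine le_antisymm (mul_self_le_self_of_norm_le_one h0 h1.le) ?_
    have key (c : ℝ) (hc : c ∈ Set.Ioo (0 : ℝ) 1) : c • h ≤ h * h := by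
      have hx : IsSelfAdjoint (h * h - c • h) := hhsa.sub ((IsSelfAdjoint.all c).smul hsa)
      rcases nonneg_or_nonpos_of_supportLE hs hx
        (((SupportLE.refl h).mul h).sub ((SupportLE.refl h).smul c)) with h2 | h2
      · exact sub_nonneg.1 h2
      · have h3 := CStarAlgebra.norm_le_norm_of_nonneg_of_le
          (by simpa [hsa.star_eq] using star_mul_self_nonneg h) (sub_nonpos.1 h2)
        have h4 : ‖h * h‖ = 1 := by
          have := CStarRing.norm_star_mul_self (x := h)
          rwa [hsa.star_eq, h1, one_mul] at this
        rw [h4, norm_smul, h1, mul_one, Real.norm_of_nonneg hc.1.le] at h3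
        exact absurd hc.2 h3.not_gt
    have hlim : Tendsto (fun t : ℝ => t • h) (𝓝[<] 1) (𝓝 h) := by
      have : Continuous fun t : ℝ => t • h := by fun_prop
      simpa using (this.tendsto 1).mono_left nhdsWithin_le_nhds
    exact le_of_tendsto hlim (by
      filter_upwards [Ioo_mem_nhdsLT (zero_lt_one (α := ℝ))] with t ht using key t ht)
  have hreal (x : E) (hx : IsSelfAdjoint x) : ∃ c : ℝ, h * x * h = c • h := by
    have hy : IsSelfAdjoint (h * x * h) := by
      simpa [hsa.star_eq] using hx.conjugate h
    set y := h * x * h with hy_def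
    have hyh : SupportLE y h := by
      rw [hy_def, mul_assoc]
      exact (SupportLE.refl h).mul _
    have hor (c : ℝ) : c • h ≤ y ∨ y ≤ c • h := by
      rcases nonneg_or_nonpos_of_supportLE hs (hy.sub ((IsSelfAdjoint.all c).smul hsa))
        (hyh.sub ((SupportLE.refl h).smul c)) with h2 | h2
      · exact .inl (sub_nonneg.1 h2)
      · exact .inr (sub_nonpos.1 h2)
    -- The two closed sets of `c` cover the line and are nonempty, so by connectedness they meet.
    obtain ⟨c, -, hc1, hc2⟩ := isPreconnected_closed_iff.1 (isPreconnected_univ (α := ℝ))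
      {c | c • h ≤ y} {c | y ≤ c • h} (isClosed_le (by fun_prop) continuous_const)
      (isClosed_le continuous_const (by fun_prop)) (fun c _ => hor c)
      ⟨-(‖y‖ + 1), trivial, (hor _).resolve_right fun h2 => by
        have := norm_le_of_nonneg_sub_smul h0 h1 (c := ‖y‖ + 1) (x := -y)
          (by rw [neg_smul] at h2; exact le_neg_of_le_neg h2)
        rw [norm_neg] at this
        linarith⟩
      ⟨‖y‖ + 1, trivial, (hor _).resolve_left fun h2 => by
        have := norm_le_of_nonneg_sub_smul h0 h1 h2
        linarith⟩
    exact ⟨c, le_antisymm hc2 hc1⟩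
  refine ⟨⟨hmul, hsa⟩, by rintro rfl; simp at h1, fun x => ?_⟩
  obtain ⟨c, hc⟩ := hreal _ (realPart x).2
  obtain ⟨d, hd⟩ := hreal _ (imaginaryPart x).2
  refine ⟨c + Complex.I * d, ?_⟩
  conv_lhs => rw [← realPart_add_I_smul_imaginaryPart x]
  rw [mul_add, add_mul, hc, mul_smul_comm, smul_mul_assoc, hd, add_smul, mul_smul,
    Complex.coe_smul, Complex.coe_smul]

/-- Otherwise every nonzero positive element below `h` splits into two orthogonal pieces; keeping
one piece and splitting the other forever yields an orthogonal sequence. -/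
theorem exists_isMinimalProjection_supportLE (hE : ¬ HasOrthogonalSequence E) {h : E} (h0 : 0 ≤ h)
    (hne : h ≠ 0) : ∃ p, IsMinimalProjection p ∧ SupportLE p h := by
  by_contra! hno
  let S := {x : E // 0 ≤ x ∧ x ≠ 0 ∧ SupportLE x h}
  have hsplit (x : S) : ∃ a b : S, SupportLE a.1 x.1 ∧ SupportLE b.1 x.1 ∧ a.1 * b.1 = 0 := by
    by_contra! hcon
    have hpos : 0 < ‖x.1‖ := norm_pos_iff.2 x.2.2.1
    have hle : SupportLE (‖x.1‖⁻¹ • x.1) h := x.2.2.2.smul _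
    refine hno _ (isMinimalProjection_of_not_split (smul_nonneg (by positivity) x.2.1)
      (by simp [norm_smul, hpos.ne']) fun a b ha hb hax hbx hab => ?_) hle
    by_contra! h2
    exact hcon ⟨a, ha, h2.1, hax.trans hle⟩ ⟨b, hb, h2.2, hbx.trans hle⟩
      (hax.trans ((SupportLE.refl x.1).smul _)) (hbx.trans ((SupportLE.refl x.1).smul _)) hab
  choose a b ha hb hab using hsplit
  let s : ℕ → S := fun n => b^[n] ⟨h, h0, hne, SupportLE.refl h⟩
  have hs (n : ℕ) : s (n + 1) = b (s n) := Function.iterate_succ_apply' b n _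
  have hanti (m k : ℕ) : SupportLE (s (m + k)).1 (s m).1 := by
    induction k with
    | zero => exact SupportLE.refl _
    | succ k ih =>
      rw [← add_assoc, hs]
      exact (hb _).trans ih
  have horth (m n : ℕ) (hmn : m < n) : (a (s m)).1 * (a (s n)).1 = 0 := by
    obtain ⟨k, rfl⟩ := Nat.exists_eq_add_of_le (Nat.succ_le_of_lt hmn)
    refine ((ha _).trans (hanti (m + 1) k)) _ ?_
    rw [hs]
    exact hab _
  refine hE ⟨fun n => (a (s n)).1, fun n => CStarAlgebra.nonneg_iff_eq_star_mul_self.1 (a (s n)).2.1,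
    fun n => (a (s n)).2.2.1, fun m n hmn => ?_⟩
  rcases hmn.lt_or_gt with hlt | hlt
  · exact horth m n hlt
  · have := congrArg star (horth n m hlt)
    rwa [star_mul, (IsSelfAdjoint.of_nonneg (a (s m)).2.1).star_eq,
      (IsSelfAdjoint.of_nonneg (a (s n)).2.1).star_eq, star_zero] at this

end Order

/-- For a nonzero `u` in `pEq`, both `u⋆u = cq` and `uu⋆ = cp` hold with the same `c ≠ 0`, so `c •
pxq = u (u⋆x) q` is a multiple of `u`. -/
theorem IsMinimalProjection.exists_corner_generator {p q : E} (hp : IsMinimalProjection p) (hq : IsMinimalProjection q) :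
    ∃ u : E, ∀ x, ∃ c : ℂ, p * x * q = c • u := by
  by_cases h : ∀ x, p * x * q = 0
  · exact ⟨0, fun x => ⟨0, by simp [h]⟩⟩
  push Not at h
  obtain ⟨x₀, hx₀⟩ := h
  have hpp : p * p = p := hp.proj.1
  have hqq : q * q = q := hq.proj.1
  have hps : star p = p := hp.proj.2
  have hqs : star q = q := hq.proj.2
  set u := p * x₀ * q with hu
  have hpu : p * u = u := by rw [hu, ← mul_assoc, ← mul_assoc, hpp]
  have huq : u * q = u := by rw [hu, mul_assoc, hqq]
  have hus : star u = q * star x₀ * p := by rw [hu, star_mul, star_mul, hps, hqs, mul_assoc]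
  have hqu : q * star u = star u := by rw [← hqs, ← star_mul, huq]
  have hup : star u * p = star u := by rw [← hps, ← star_mul, hpu]
  obtain ⟨c, hc⟩ := hq.exists_smul (star u * u)
  obtain ⟨c', hc'⟩ := hp.exists_smul (u * star u)
  rw [← mul_assoc, hqu, mul_assoc, huq] at hc
  rw [← mul_assoc, hpu, mul_assoc, hup] at hc'
  have hcc : c' • u = c • u := by
    calc c' • u = (u * star u) * u := by rw [hc', smul_mul_assoc, hpu]
      _ = c • u := by rw [mul_assoc, hc, mul_smul_comm, huq]
  have hc0 : c ≠ 0 := by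
    rintro rfl
    rw [zero_smul, CStarRing.star_mul_self_eq_zero_iff] at hc
    exact hx₀ hc
  refine ⟨u, fun x => ?_⟩
  obtain ⟨d, hd⟩ := hq.exists_smul (star u * x)
  refine ⟨c⁻¹ * d, ?_⟩
  have h1 : c • (p * x * q) = d • u := by
    calc c • (p * x * q) = (c' • p) * x * q := by
          rw [smul_left_injective ℂ hx₀ hcc, smul_mul_assoc, smul_mul_assoc]
      _ = u * (q * (star u * x) * q) := by
          rw [← hc']
          conv_rhs => rw [← mul_assoc q, hqu]
          simp only [mul_assoc]
      _ = d • u := by rw [hd, mul_smul_comm, huq]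
  rw [mul_smul, ← h1, smul_smul, inv_mul_cancel₀ hc0, one_smul]

/-- If there is no such sequence, a maximal orthogonal family of minimal projections is finite and
sums to a unit, so `E` is a finite sum of corners `pEq` of dimension at most one. -/
theorem hasOrthogonalSequence_of_infinite_dimensional (hE : ¬ FiniteDimensional ℂ E) :
    HasOrthogonalSequence E := by
  classical
  let _ := CStarAlgebra.spectralOrder E
  have := CStarAlgebra.spectralOrderedRing E
  by_contra hno
  obtain ⟨S, hS⟩ := zorn_subset
    {S : Set E | (∀ p ∈ S, IsMinimalProjection p) ∧ S.Pairwise fun p q => p * q = 0} (fun c hc hchain =>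
      ⟨⋃₀ c, ⟨fun p ⟨s, hs, hp⟩ => (hc hs).1 p hp,
        (Set.pairwise_sUnion hchain.directedOn).2 fun s hs => (hc hs).2⟩,
        fun s hs => Set.subset_sUnion_of_mem hs⟩)
  obtain ⟨hatom, horth⟩ := hS.prop
  have hfin : S.Finite := by
    by_contra hinf
    let f := Set.Infinite.natEmbedding S hinf
    refine hno ⟨fun n => f n, fun n => ⟨f n, ?_⟩, fun n => (hatom _ (f n).2).ne_zero,
      fun m n hmn => horth (f m).2 (f n).2 fun h => hmn (f.injective (Subtype.ext h))⟩
    rw [(hatom _ (f n).2).proj.2.star_eq]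
    exact (hatom _ (f n).2).proj.1.symm
  let s := hfin.toFinset
  have hs {p : E} : p ∈ s ↔ p ∈ S := hfin.mem_toFinset
  let P := ∑ p ∈ s, p
  have hPp {p : E} (hp : p ∈ S) : P * p = p := by
    rw [Finset.sum_mul, Finset.sum_eq_single_of_mem p (hs.2 hp)
      (fun q hq hqp => horth (hs.1 hq) hp hqp)]
    exact (hatom p hp).proj.1
  have hPs : star P = P := by
    rw [star_sum]
    exact Finset.sum_congr rfl fun p hp => (hatom p (hs.1 hp)).proj.2
  have hright (x : E) : x * P = x := by
    by_contra hne
    -- A minimal projection supported under `y⋆y` is orthogonal to the whole family, so maximality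
    -- puts it inside, where it is orthogonal to itself.
    let y := x - x * P
    have hy : y ≠ 0 := fun h => hne (sub_eq_zero.1 h).symm
    obtain ⟨q, hq, hqle⟩ := exists_isMinimalProjection_supportLE hno (star_mul_self_nonneg y)
      (mt (CStarRing.star_mul_self_eq_zero_iff y).1 hy)
    have hyp {p : E} (hp : p ∈ S) : y * p = 0 := by
      rw [sub_mul, mul_assoc, hPp hp, sub_self]
    have hpq {p : E} (hp : p ∈ S) : p * q = 0 := by
      refine hqle p ?_
      have := congrArg star (hyp hp)
      rw [star_mul, (hatom p hp).proj.2.star_eq, star_zero] at this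
      rw [← mul_assoc, this, zero_mul]
    have hqp {p : E} (hp : p ∈ S) : q * p = 0 := by
      have := congrArg star (hpq hp)
      rwa [star_mul, (hatom p hp).proj.2.star_eq, hq.proj.2.star_eq, star_zero] at this
    have hqS : q ∈ S := by
      refine hS.le_of_ge (y := insert q S) ⟨?_, ?_⟩ (Set.subset_insert q S) (Set.mem_insert q S)
      · rintro p (rfl | hp)
        exacts [hq, hatom p hp]
      · exact horth.insert fun p hp _ => ⟨hqp hp, hpq hp⟩
    exact hq.ne_zero (hq.proj.1.symm.trans (hpq hqS))
  have hleft (x : E) : P * x = x := by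
    have := congrArg star (hright (star x))
    rwa [star_mul, star_star, hPs] at this
  have hgen (pq : s × s) : ∃ u : E, ∀ x, ∃ c : ℂ, pq.1 * x * pq.2 = c • u :=
    (hatom _ (hs.1 pq.1.2)).exists_corner_generator (hatom _ (hs.1 pq.2.2))
  choose u hu using hgen
  refine hE ⟨⟨Finset.univ.image u, eq_top_iff.2 fun x _ => ?_⟩⟩
  have hx : x = ∑ p : s, ∑ q : s, (p : E) * x * q := by
    conv_lhs => rw [← hright x, ← hleft x]
    simp only [P, Finset.sum_mul, Finset.mul_sum]
    rw [Finset.sum_comm, ← Finset.sum_coe_sort s]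
    refine Finset.sum_congr rfl fun p _ => ?_
    rw [← Finset.sum_coe_sort s]
  rw [hx]
  refine Submodule.sum_mem _ fun p _ => Submodule.sum_mem _ fun q _ => ?_
  obtain ⟨c, hc⟩ := hu (p, q) x
  rw [hc]
  exact Submodule.smul_mem _ _ (Submodule.subset_span (by simp))

theorem exists_orthogonal_sequence [PartialOrder E] [StarOrderedRing E]
    (hE : ¬ FiniteDimensional ℂ E) :
    ∃ f : ℕ → E, (∀ n, 0 ≤ f n) ∧ (∀ n, ‖f n‖ = 1) ∧ ∀ m n, m ≠ n → f m * f n = 0 := by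
  obtain ⟨f, h0, h1, h2⟩ := hasOrthogonalSequence_of_infinite_dimensional hE
  refine ⟨fun n => ‖f n‖⁻¹ • f n, fun n => smul_nonneg (by positivity) ?_, fun n => ?_,
    fun m n hmn => ?_⟩
  · obtain ⟨x, hx⟩ := h0 n
    rw [hx]
    exact star_mul_self_nonneg x
  · simp [norm_smul, h1 n]
  · rw [smul_mul_smul_comm, h2 m n hmn, smul_zero]

end Atoms

/-! ### Weak-* null sequences and the bidual. -/

section Grothendieck

variable {X : Type*} [NormedAddCommGroup X] [NormedSpace ℂ X]

theorem tendsto_apply_zero_of_denseRange {ι : Type*} {j : ι → X} (hj : DenseRange j)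
    {Θ : ℕ → StrongDual ℂ X} (hΘ : ∀ n, ‖Θ n‖ ≤ 1)
    (h : ∀ i, Tendsto (fun n => Θ n (j i)) atTop (𝓝 0)) (x : X) :
    Tendsto (fun n => Θ n x) atTop (𝓝 0) := by
  rw [Metric.tendsto_atTop]
  intro ε hε
  obtain ⟨i, hi⟩ := hj.exists_dist_lt x (half_pos hε)
  obtain ⟨N, hN⟩ := Metric.tendsto_atTop.1 (h i) (ε / 2) (half_pos hε)
  refine ⟨N, fun n hn => ?_⟩
  have h1 := hN n hn
  rw [dist_zero_right] at h1 ⊢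
  have h2 : ‖Θ n (x - j i)‖ < ε / 2 := by
    refine lt_of_le_of_lt ((Θ n).le_opNorm _) (lt_of_le_of_lt ?_ (dist_eq_norm x (j i) ▸ hi))
    exact mul_le_of_le_one_left (norm_nonneg _) (hΘ n)
  calc ‖Θ n x‖ = ‖Θ n (x - j i) + Θ n (j i)‖ := by rw [← map_add, sub_add_cancel]
    _ ≤ _ := norm_add_le _ _
    _ < ε := by linarith

theorem IsGrothendieckSpace.not_biorthogonal (hX : IsGrothendieckSpace ℂ X)
    {Θ : ℕ → StrongDual ℂ X} (hΘ : ∀ x, Tendsto (fun n => Θ n x) atTop (𝓝 0))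
    {z : ℕ → X} (hz : ∀ N, ‖z N‖ ≤ 1) : ¬ ∀ m N, m < N → Θ m (z N) = 1 := by
  intro h
  have hw := hX Θ (by
    rw [tendsto_iff_forall_eval_tendsto_topDualPairing]
    exact fun x => hΘ x)
  let u : ℕ → WeakDual ℂ (StrongDual ℂ X) := fun N =>
    StrongDual.toWeakDual (NormedSpace.inclusionInDoubleDual ℂ X (z N))
  have hu (N : ℕ) : u N ∈ WeakDual.toStrongDual ⁻¹'
      Metric.closedBall (0 : StrongDual ℂ (StrongDual ℂ X)) 1 := by
    have h1 := (NormedSpace.double_dual_bound ℂ X (z N)).trans (hz N)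
    exact (dist_zero_right (NormedSpace.inclusionInDoubleDual ℂ X (z N))).trans_le h1
  obtain ⟨Λ, -, hΛ⟩ := (WeakDual.isCompact_closedBall (𝕜 := ℂ)
    (0 : StrongDual ℂ (StrongDual ℂ X)) 1).exists_mapClusterPt (f := atTop) (u := u)
    (le_principal_iff.2 (mem_map.2 (Eventually.of_forall hu)))
  obtain ⟨U, hU, hlim⟩ := mapClusterPt_iff_ultrafilter.1 hΛ
  have h1 (m : ℕ) : Λ (Θ m) = 1 := by
    have e1 : Tendsto (fun N => u N (Θ m)) U (𝓝 (Λ (Θ m))) :=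
      ((WeakDual.eval_continuous (Θ m)).tendsto Λ).comp hlim
    have e2 : Tendsto (fun N => u N (Θ m)) U (𝓝 1) := by
      refine tendsto_const_nhds.congr' (hU ?_)
      filter_upwards [eventually_gt_atTop m] with N hN
      exact (h m N hN).symm
    exact tendsto_nhds_unique e1 e2
  have h2 : Tendsto (fun n => Λ (Θ n)) atTop (𝓝 (Λ 0)) :=
    ((WeakBilin.eval_continuous (topDualPairing ℂ (StrongDual ℂ X)).flip
      (WeakDual.toStrongDual Λ)).tendsto 0).comp hw
  simp only [h1, map_zero] at h2
  exact one_ne_zero (tendsto_nhds_unique tendsto_const_nhds h2)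

end Grothendieck

/-! ### Averages over random signs. -/

section Rademacher

/-- The sign of a truth value. -/
def boolSign (b : Bool) : ℂ := if b then 1 else -1

theorem boolSign_mul_self (b : Bool) : boolSign b * boolSign b = 1 := by
  cases b <;> simp [boolSign]

theorem norm_boolSign (b : Bool) : ‖boolSign b‖ = 1 := by
  cases b <;> simp [boolSign]

theorem star_boolSign (b : Bool) : star (boolSign b) = boolSign b := by
  cases b <;> simp [boolSign]

/-- The offset `γ` absorbs the first signed term, so the induction step is the parallelogram law. -/
theorem sum_norm_sum_boolSign_sq (n : ℕ) (β : Fin n → ℂ) (γ : ℂ) :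
    ∑ s : Fin n → Bool, ‖γ + ∑ i, boolSign (s i) * β i‖ ^ 2 =
      2 ^ n * (‖γ‖ ^ 2 + ∑ i, ‖β i‖ ^ 2) := by
  induction n generalizing γ with
  | zero => simp
  | succ n ih =>
    rw [← (Fin.consEquiv fun _ : Fin (n + 1) => Bool).sum_comp, Fintype.sum_prod_type,
      Fintype.sum_bool]
    have h1 := ih (fun i => β i.succ) (γ + β 0)
    have h2 := ih (fun i => β i.succ) (γ - β 0)
    have h3 := parallelogram_law_with_norm ℝ γ (β 0)
    simp only [Fin.consEquiv_apply, Fin.sum_univ_succ, Fin.cons_zero, Fin.cons_succ,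
      boolSign, if_true, Bool.false_eq_true, if_false, one_mul, neg_mul, ← add_assoc,
      ← sub_eq_add_neg] at h1 h2 ⊢
    rw [h1, h2, pow_succ]
    linear_combination (2 ^ n : ℝ) * h3

/-- Cauchy-Schwarz over the patterns `s` gains a factor `√n` over the trivial bound `2 ^ n * n * (M
* N)`. -/
theorem norm_sum_boolSign_mul_sq_le {n : ℕ} {c : (Fin n → Bool) → ℂ} {β : Fin n → ℂ} {M N : ℝ}
    (hc : ∀ s, ‖c s‖ ≤ M) (hβ : ∀ i, ‖β i‖ ≤ N) :
    ‖∑ s : Fin n → Bool, ∑ i, boolSign (s i) * (c s * β i)‖ ^ 2 ≤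
      (2 ^ n) ^ 2 * n * (M * N) ^ 2 := by
  have h1 : ‖∑ s : Fin n → Bool, ∑ i, boolSign (s i) * (c s * β i)‖ ≤
      ∑ s : Fin n → Bool, ‖c s‖ * ‖∑ i, boolSign (s i) * β i‖ := by
    refine (norm_sum_le _ _).trans (Finset.sum_le_sum fun s _ => ?_)
    rw [← norm_mul, Finset.mul_sum]
    refine le_of_eq (congrArg _ (Finset.sum_congr rfl fun i _ => by ring))
  have h2 := sum_norm_sum_boolSign_sq n β 0
  simp only [zero_add, norm_zero] at h2
  calc _ ≤ (∑ s : Fin n → Bool, ‖c s‖ * ‖∑ i, boolSign (s i) * β i‖) ^ 2 := by gcongr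
    _ ≤ (∑ s, ‖c s‖ ^ 2) * ∑ s : Fin n → Bool, ‖∑ i, boolSign (s i) * β i‖ ^ 2 :=
        Finset.sum_mul_sq_le_sq_mul_sq _ _ _
    _ ≤ (∑ s : Fin n → Bool, M ^ 2) * (2 ^ n * ∑ i : Fin n, N ^ 2) := by
        rw [h2, zero_pow two_ne_zero, zero_add]
        gcongr with s _ i _
        exacts [hc s, hβ i]
    _ = _ := by
        simp
        ring

end Rademacher

/-! ### The weak-* null sequence that is not weakly null. -/

section Main

variable {A E F : Type*} [NonUnitalCStarAlgebra A] [NonUnitalCStarAlgebra E]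
  [NonUnitalCStarAlgebra F]
  [PartialOrder A] [StarOrderedRing A] [PartialOrder E] [StarOrderedRing E]
  [PartialOrder F] [StarOrderedRing F]

namespace TensorRep

theorem exists_product_functional {T : E ⊗[ℂ] F →⋆ₙₐ[ℂ] A} (hT : Function.Injective T) {f : E}
    (hf : 0 ≤ f) (hf1 : ‖f‖ = 1) {φ : E →ₗ[ℂ] ℂ} (hφ : IsPeakState f φ)
    (hpure : ∀ τ : E →ₗ[ℂ] ℂ, (∀ x, 0 ≤ x → 0 ≤ τ x) → (∀ x, 0 ≤ x → τ x ≤ φ x) → τ = τ f • φ)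
    {ψ : StrongDual ℂ F} (hψ : ‖ψ‖ ≤ 1) :
    ∃ Ψ : StrongDual ℂ A, ‖Ψ‖ ≤ 1 ∧ ∀ a y, Ψ (T (a ⊗ₜ y)) = φ a * ψ y := by
  obtain ⟨Ψ, h1, h2⟩ := exists_dual_of_forall_norm_le (T : E ⊗[ℂ] F →ₗ[ℂ] A)
    (ψ.toLinearMap ∘ₗ (TensorProduct.lid ℂ F).toLinearMap ∘ₗ TensorProduct.map φ LinearMap.id)
    zero_le_one (fun x => by
      refine (ψ.le_opNorm _).trans (mul_le_mul hψ ?_ (norm_nonneg _) zero_le_one)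
      exact norm_slice_le hT hf hf1 hφ hpure x)
  exact ⟨Ψ, h1, fun a y => (h2 (a ⊗ₜ y)).trans (by simp)⟩

theorem finiteDimensional_or_finiteDimensional (hA : IsGrothendieckSpace ℂ A)
    (T : E ⊗[ℂ] F →⋆ₙₐ[ℂ] A) (hT : Function.Injective T) (hd : DenseRange T) :
    FiniteDimensional ℂ E ∨ FiniteDimensional ℂ F := by
  by_contra! hcon
  obtain ⟨f, hf0, hf1, hf⟩ := exists_orthogonal_sequence (E := E) hcon.1
  obtain ⟨g, hg0, hg1, hg⟩ := exists_orthogonal_sequence (E := F) hcon.2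
  choose φ hφ hpure using fun k => exists_pure_isPeakState (hf0 k) (hf1 k)
  choose ψ hψ1 hψ using fun i => exists_dual_isPeakState (hg0 i) (hg1 i)
  choose Ψ hΨ1 hΨ using fun k i =>
    exists_product_functional hT (hf0 k) (hf1 k) (hφ k) (hpure k) (hψ1 i)
  have hφf (k l : ℕ) : φ k (f l) = if k = l then 1 else 0 := by
    split_ifs with h
    · exact h ▸ (hφ k).map_self
    · rw [← (hφ k).map_left, hf k l h, map_zero]
  have hψg (i j : ℕ) : ψ i (g j) = if i = j then 1 else 0 := by
    split_ifs with h
    · exact h ▸ (hψ i).map_self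
    · have := (hψ i).map_left (g j)
      rw [hg i j h, map_zero] at this
      exact this.symm
  -- Each pattern gets its own `f`, which separates patterns and blocks; the same `g 0, …, g n`
  -- serve all patterns of a block.
  let ι : (Σ n : ℕ, (Fin (n + 1) → Bool)) → ℕ := Encodable.encode
  have hι : Function.Injective ι := Encodable.encode_injective
  -- The reciprocal of the number of pairs `(s, i)` in block `n`.
  let r (n : ℕ) : ℝ := ((n + 1 : ℝ) * 2 ^ (n + 1))⁻¹
  have hr (n : ℕ) : 0 < r n := by positivity
  let Θ (n : ℕ) : StrongDual ℂ A :=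
    (r n : ℂ) • ∑ s : Fin (n + 1) → Bool, ∑ i : Fin (n + 1), boolSign (s i) • Ψ (ι ⟨n, s⟩) i
  have hΘT (n : ℕ) (a : E) (y : F) : Θ n (T (a ⊗ₜ y)) =
      r n * ∑ s : Fin (n + 1) → Bool, ∑ i : Fin (n + 1),
        boolSign (s i) * (φ (ι ⟨n, s⟩) a * ψ i y) := by
    simp [Θ, hΨ]
  have hΘ1 (n : ℕ) : ‖Θ n‖ ≤ 1 := by
    have h1 : ‖∑ s : Fin (n + 1) → Bool, ∑ i : Fin (n + 1), boolSign (s i) • Ψ (ι ⟨n, s⟩) i‖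
        ≤ ∑ s : Fin (n + 1) → Bool, ∑ i : Fin (n + 1), (1 : ℝ) := by
      refine norm_sum_le_of_le _ fun s _ => norm_sum_le_of_le _ fun i _ => ?_
      rw [norm_smul, norm_boolSign, one_mul]
      exact hΨ1 _ _
    have h2 : (∑ s : Fin (n + 1) → Bool, ∑ i : Fin (n + 1), (1 : ℝ)) = (r n)⁻¹ := by
      simp [r]
      ring
    rw [norm_smul, Complex.norm_real, Real.norm_of_nonneg (hr n).le]
    calc _ ≤ r n * (r n)⁻¹ := by gcongr; exact h1.trans_eq h2
      _ = 1 := mul_inv_cancel₀ (hr n).ne'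
  have hΘ0 (x : A) : Tendsto (fun n => Θ n x) atTop (𝓝 0) := by
    refine tendsto_apply_zero_of_denseRange hd hΘ1 (fun t => ?_) x
    induction t with
    | zero => simp
    | add t u ht hu => simpa using ht.add hu
    | tmul a y =>
      have hbound (n : ℕ) : ‖Θ n (T (a ⊗ₜ y))‖ ^ 2 ≤ (‖a‖ * ‖y‖) ^ 2 * (1 / ((n : ℝ) + 1)) := by
        have h1 := norm_sum_boolSign_mul_sq_le (c := fun s => φ (ι ⟨n, s⟩) a)
          (β := fun i : Fin (n + 1) => ψ i y) (M := ‖a‖) (N := ‖y‖)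
          (fun s => (hφ _).norm_apply_le (hf0 _) a) (fun i => (hψ i).norm_apply_le (hg0 i) y)
        rw [hΘT, norm_mul, mul_pow, Complex.norm_real, Real.norm_of_nonneg (hr n).le]
        calc _ ≤ r n ^ 2 * ((2 ^ (n + 1)) ^ 2 * ((n + 1 : ℕ) : ℝ) * (‖a‖ * ‖y‖) ^ 2) := by gcongr
          _ = _ := by
            simp only [r]
            push_cast
            field_simp
      have hlim : Tendsto (fun n : ℕ => (‖a‖ * ‖y‖) ^ 2 * (1 / ((n : ℝ) + 1))) atTop (𝓝 0) := by
        simpa using tendsto_one_div_add_atTop_nhds_zero_nat.const_mul ((‖a‖ * ‖y‖) ^ 2)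
      have h2 := squeeze_zero (fun n => sq_nonneg _) hbound hlim
      rw [tendsto_zero_iff_norm_tendsto_zero]
      simpa using h2.sqrt
  let I := Σ n : ℕ, (Fin (n + 1) → Bool) × Fin (n + 1)
  let w (p : I) : A := boolSign (p.2.1 p.2.2) • T (f (ι ⟨p.1, p.2.1⟩) ⊗ₜ g p.2.2)
  have hwsa (p : I) : IsSelfAdjoint (w p) :=
    (show IsSelfAdjoint (boolSign _) from star_boolSign _).smul
      (.of_nonneg (nonneg T (hf0 _) (hg0 _)))
  have hw1 (p : I) : ‖w p‖ = 1 := by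
    simp only [w]
    rw [norm_smul, norm_boolSign, norm_eq hT, hf1, hg1, one_mul, one_mul]
  have hworth (p q : I) (hpq : p ≠ q) : w p * w q = 0 := by
    simp only [w]
    rw [smul_mul_smul_comm, ← map_mul, Algebra.TensorProduct.tmul_mul_tmul]
    obtain ⟨n, s, i⟩ := p
    obtain ⟨m, t, j⟩ := q
    by_cases h : (⟨n, s⟩ : Σ n : ℕ, (Fin (n + 1) → Bool)) = ⟨m, t⟩
    · obtain ⟨rfl, h⟩ := Sigma.mk.inj_iff.1 h
      obtain rfl := eq_of_heq h
      have hij : (i : ℕ) ≠ j := fun hij => hpq (by rw [Fin.ext hij])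
      simp [hg _ _ hij]
    · simp [hf _ _ fun h' => h (hι h')]
  let z (N : ℕ) : A := ∑ p ∈ (Finset.range N).sigma fun _ => Finset.univ, w p
  have hz (N : ℕ) : ‖z N‖ ≤ 1 := by
    have h1 := IsSelfAdjoint.nnnorm_sum_eq_sup
      ((Finset.range N).sigma fun n => (Finset.univ : Finset ((Fin (n + 1) → Bool) × Fin (n + 1))))
      (fun p _ => hwsa p) (fun p q hpq => hworth p q hpq)
    have h2 : ‖z N‖₊ ≤ 1 := by
      rw [h1]
      exact Finset.sup_le fun p _ => (hw1 p).le
    exact h2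
  refine hA.not_biorthogonal hΘ0 hz fun m N hmN => ?_
  -- The sign in `w` cancels the one in `Θ`, so every member of block `m` contributes `r m`, for a
  -- total of one.
  have hΘw (n : ℕ) (s : Fin (n + 1) → Bool) (i : Fin (n + 1)) :
      Θ m (w ⟨n, s, i⟩) = if n = m then (r m : ℂ) else 0 := by
    simp only [w]
    rw [map_smul, hΘT]
    split_ifs with h
    · subst h
      rw [Finset.sum_eq_single s, Finset.sum_eq_single i]
      · rw [hφf, hψg, if_pos rfl, if_pos rfl, smul_eq_mul]
        linear_combination (r n : ℂ) * boolSign_mul_self (s i)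
      · intro j _ hj
        rw [hψg, if_neg (fun h => hj (Fin.ext h)), mul_zero, mul_zero]
      · simp
      · intro t _ ht
        refine Finset.sum_eq_zero fun j _ => ?_
        rw [hφf, if_neg (fun h => ht (by simpa using hι h)), zero_mul, mul_zero]
      · simp
    · rw [Finset.sum_eq_zero, mul_zero, smul_zero]
      refine fun t _ => Finset.sum_eq_zero fun j _ => ?_
      rw [hφf, if_neg (fun h' => h (congrArg Sigma.fst (hι h')).symm), zero_mul, mul_zero]
  simp only [z, map_sum, Finset.sum_sigma, Fintype.sum_prod_type, hΘw]
  rw [Finset.sum_eq_single m]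
  · simp [r]
    field_simp
  · intro n _ hn
    simp [hn]
  · simp [hmN]

end TensorRep

end Main

end

theorem theorem1 {A E F : Type*} [NonUnitalCStarAlgebra A] [NonUnitalCStarAlgebra E]
    [NonUnitalCStarAlgebra F] (hA : IsGrothendieckSpace ℂ A) (γ : CStarNorm (E ⊗[ℂ] F))
    (e : A ≃⋆ₐ[ℂ] CStarTensorProduct E F γ) :
    FiniteDimensional ℂ E ∨ FiniteDimensional ℂ F := by
  let _ := CStarAlgebra.spectralOrder A
  have := CStarAlgebra.spectralOrderedRing A
  let _ := CStarAlgebra.spectralOrder E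
  have := CStarAlgebra.spectralOrderedRing E
  let _ := CStarAlgebra.spectralOrder F
  have := CStarAlgebra.spectralOrderedRing F
  let j : E ⊗[ℂ] F →⋆ₙₐ[ℂ] CStarTensorProduct E F γ :=
    { toFun := fun x => CStarNorm.Completion.of γ x
      map_smul' := fun c x => (CStarNorm.Completion.of γ).map_smul c x
      map_zero' := (CStarNorm.Completion.of γ).map_zero
      map_add' := fun x y => (CStarNorm.Completion.of γ).map_add x y
      map_mul' := fun x y => CStarNorm.Completion.of_mul (γ := γ) x y
      map_star' := fun x => CStarNorm.Completion.of_star (γ := γ) x }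
  let e' : CStarTensorProduct E F γ →⋆ₙₐ[ℂ] A := e.symm
  have he' : Function.Injective e' := e.symm.injective
  refine TensorRep.finiteDimensional_or_finiteDimensional hA (e'.comp j)
    (he'.comp (CStarNorm.Completion.of γ).injective) ?_
  have hj : DenseRange j := (CStarNorm.Completion.isDenseInducing_of (γ := γ)).dense
  exact (e.symm.surjective.denseRange).comp hj (NonUnitalStarAlgHom.isometry e' he').continuous
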